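/- Let $k\ge 1$, $N\ge k$, and let $f_1,\dots,f_N$ be real affine forms on $\mathbb R^k$ whose zero sets $H_j=\{f_j=0\}$ are hyperplanes in generic position: they are distinct, any $k$ of them meet in exactly one point, and no $k+1$ of them have a common point. Let $l_j=f_j-f_j(0)$ and let $\alpha_1,\dots,\alpha_N>0$. A vertex is a subset $X\subset\{1,\dots,N\}$ with $k$ elements, also viewed as the point $\bigcap_{j\in X}H_j$; $\mathcal X$ is the set of vertices and $\alpha_X=\sum_{j\in X}\alpha_j$. Let $f_0$ be a linear form on $\mathbb R^k$ that takes distinct values at distinct vertices and is nonconstant on each line $L_U=\bigcap_{j\in U}H_j$, $|U|=k-1$; let $e_U$ be the vector directing $L_U$ with $f_0(e_U)=1$. For a vertex $X'$ let $\omega_{X'}=\frac{df_{j_1}}{f_{j_1}}\wedge\dots\wedge\frac{df_{j_k}}{f_{j_k}}$, where $X'=\{j_1,\dots,j_k\}$ is ordered so that $df_{j_1}\wedge\dots\wedge df_{j_k}$ is positively oriented (so $\omega_{X'}=|\det(l_{j_1},\dots,l_{j_k})|\,\frac{dz_1\wedge\dots\wedge dz_k}{f_{j_1}\cdots f_{j_k}}$,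 also when $k=1$), and $\Omega_{X'}=\big(\prod_{j=1}^N|f_j|^{\alpha_j}\big)\,\omega_{X'}$. For a vertex $X$ and $|\rho|=1$, $\rho\notin\mathbb R$, let $\mathcal C_X^\rho=\{X+\rho\sum_{j\in X}a_je_{X\setminus\{j\}}: a_j>0\}\subset\mathbb C^k$, oriented as the image of $\mathcal C^+_X=\mathcal C_X^1\subset\mathbb R^k$ under $x\mapsto X+\rho(x-X)$, and $$I^\rho_{X,X'}(\lambda)=\int_{\mathcal C^\rho_X}e^{-\lambda f_0}\,\Omega_{X'},$$ where on $\mathcal C^\rho_X$ the form $\Omega_{X'}$ is the analytic extension of its real branch on $\Delta_X$, the connected component of $\mathbb R^k\setminus\bigcup_jH_j$ that has $X$ in its boundary and on which $f_0>f_0(X)$; the extension is made through the cones with $\operatorname{Im}\rho<0$, respectively with $\operatorname{Im}\rho>0$. Let $I^{+}_{X,X'}(\lambda)$ (respectively $I^-_{X,X'}(\lambda)$) be the common value of $I^\rho_{X,X'}(\lambda)$ over all $\rho$ with $|\rho|=1$, $\operatorname{Im}\rho<0$ (respectively $\operatorname{Im}\rho>0$) and $\operatorname{Re}(\rho\lambda)>0$;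 it is defined for $\lambda\in\mathbb C\setminus i\mathbb R_{\mp}$, where $\mathbb R_\pm$ denote the closed half-axes. Put $I^\pm_X=(I^\pm_{X,X'})_{X'\in\mathcal X}$. Let $\mathcal A$ be the diagonal matrix with $\mathcal A_{X,X}=f_0(X)$, and let $\mathcal B_{X,X}=\alpha_X$; $\mathcal B_{X,Y}=\operatorname{sgn}\big(l_j(e_U)l_r(e_U)\big)\alpha_r$ if $U=X\cap Y$ has $k-1$ elements, $X\setminus Y=\{j\}$ and $Y\setminus X=\{r\}$; and $\mathcal B_{X,Y}=0$ if $|X\cap Y|<k-1$. For $0<\varepsilon<\frac\pi2$ let $S_\pm=\{\lambda\ne0:\ \varepsilon-\frac\pi2<\pm\arg\lambda<\frac{3\pi}2-\varepsilon\}$. Then, for every vertex $X$ and for each choice of the sign $\pm$: (a) the integrals $I^\rho_{X,X'}(\lambda)$ with $\pm\operatorname{Im}\rho<0$ and $\operatorname{Re}(\rho\lambda)>0$ converge absolutely and do not depend on $\rho$; (b) $I^\pm_X$ is a solution of $I'=-(\mathcal A+\frac1\lambda\mathcal B)I$ on $\mathbb C\setminus i\mathbb R_\mp$; (c) for every $\varepsilon\in(0,\frac\pi2)$,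 uniformly in $S_\pm$, $$I^\pm_X(\lambda)\ \sim_{|\lambda|\to\infty}\ s_X\,D_{X,X}\,e^{-\lambda f_0(X)}\,\lambda^{-\alpha_X}\,v_X,$$ that is, the difference of the two sides is $o\big(|e^{-\lambda f_0(X)}\lambda^{-\alpha_X}|\big)$ uniformly. Here $(v_X)_{X\in\mathcal X}$ is the standard basis of $\mathbb R^{\mathcal X}$, $\lambda^{-\alpha_X}$ is taken with $-\frac\pi2<\pm\arg\lambda<\frac{3\pi}2$, and $$D_{X,X}=\Big(\prod_{j\in X}\Gamma(\alpha_j)\Big)\prod_{j\in X}|l_j(e_{X\setminus\{j\}})|^{\alpha_j}\prod_{j\notin X}|f_j(X)|^{\alpha_j},\qquad s_X=\prod_{j\in X}\operatorname{sgn}\,l_j(e_{X\setminus\{j\}})\in\{1,-1\};$$ $s_X$ is the sign of $\omega_X$ on $\mathcal C_X^+$, so that $s_X=1$ if all $f_j$, $j\in X$, are positive on $\mathcal C_X^+$. -/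

import Mathlib

open Filter Topology MeasureTheory Asymptotics

noncomputable section

/-- A real generic arrangement of `N ≥ k` affine hyperplanes `H_j = ker f_j` in `ℝ^k` (`k ≥ 1`),
with a linear form `f₀` in general position with respect to it. -/
structure GenericArrangement (k N : ℕ) where
  /-- the affine forms `f_1, …, f_N` -/
  f : Fin N → ((Fin k → ℝ) →ᵃ[ℝ] ℝ)
  /-- the linear form `f₀` -/
  f0 : (Fin k → ℝ) →ₗ[ℝ] ℝ
  one_le : 1 ≤ k
  le_card : k ≤ N
  /-- the hyperplanes are distinct -/
  distinct : ∀ i j, i ≠ j → {x | f i x = 0} ≠ {x | f j x = 0}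
  /-- any `k` hyperplanes meet in exactly one point -/
  inter_point : ∀ U : Finset (Fin N), U.card = k → ∃! x, ∀ j ∈ U, f j x = 0
  /-- no `k + 1` hyperplanes have a common point -/
  inter_empty : ∀ U : Finset (Fin N), U.card = k + 1 → ¬ ∃ x, ∀ j ∈ U, f j x = 0
  /-- `f₀` takes distinct values at distinct vertices -/
  f0_vertex : ∀ X Y : Finset (Fin N), X.card = k → Y.card = k → X ≠ Y →
    ∀ x y, (∀ j ∈ X, f j x = 0) → (∀ j ∈ Y, f j y = 0) → f0 x ≠ f0 y
  /-- `f₀` is not constant on any line that is an intersection of `k - 1` hyperplanes -/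
  f0_edge : ∀ U : Finset (Fin N), U.card + 1 = k →
    ∃ x y, (∀ j ∈ U, f j x = 0) ∧ (∀ j ∈ U, f j y = 0) ∧ f0 x ≠ f0 y

/-- Vertices, as subsets of `{1, …, N}` with `k` elements. -/
abbrev ArrVertex (k N : ℕ) : Type := {X : Finset (Fin N) // X.card = k}

/-- The extension of a real affine form on `ℝ^k` to a complex affine form on `ℂ^k`. -/
def complexifyForm {k : ℕ} (g : (Fin k → ℝ) →ᵃ[ℝ] ℝ) (z : Fin k → ℂ) : ℂ :=
  (g (fun i => (z i).re) : ℂ) + Complex.I * (g.linear (fun i => (z i).im) : ℂ)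

namespace GenericArrangement

variable {k N : ℕ} (A : GenericArrangement k N)

/-- The linear form `l_j = f_j - f_j(0)`. -/
def l (j : Fin N) : (Fin k → ℝ) →ₗ[ℝ] ℝ := (A.f j).linear

/-- A vertex as a point of `ℝ^k`. -/
def point (X : ArrVertex k N) : Fin k → ℝ := (A.inter_point X.1 X.2).choose

/-- `α_U = ∑_{j ∈ U} α_j`. -/
def weight (α : Fin N → ℝ) (U : Finset (Fin N)) : ℝ := ∑ j ∈ U, α j

/-- The vector `e_U` directing the line `L_U = ⋂_{j ∈ U} H_j` (`U` having `k - 1` elements),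
normalized by `f₀(e_U) = 1`. -/
def edgeVec (U : Finset (Fin N)) : Fin k → ℝ :=
  Classical.epsilon fun e => (∀ j ∈ U, A.l j e = 0) ∧ A.f0 e = 1

theorem point_spec (X : ArrVertex k N) {j : Fin N} (hj : j ∈ X.1) : A.f j (A.point X) = 0 :=
  (A.inter_point X.1 X.2).choose_spec.1 j hj

theorem f_eq (j : Fin N) (x p : Fin k → ℝ) : A.f j x = A.f j p + A.l j (x - p) := by
  have := (A.f j).linearMap_vsub x p
  simp only [vsub_eq_sub] at this
  simp only [l, this]; ring

theorem eq_zero_of_l (X : ArrVertex k N) (v : Fin k → ℝ) (h : ∀ j ∈ X.1, A.l j v = 0) :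
    v = 0 := by
  have hu := (A.inter_point X.1 X.2).unique (y₁ := A.point X + v) (y₂ := A.point X)
    (fun j hj => by rw [A.f_eq j _ (A.point X), A.point_spec X hj]; simp [h j hj])
    (fun j hj => A.point_spec X hj)
  simpa using hu

/-- `e_U` exists and is unique. -/
theorem existsUnique_edgeVec (U : Finset (Fin N)) (hU : U.card + 1 = k) :
    ∃! e, (∀ j ∈ U, A.l j e = 0) ∧ A.f0 e = 1 := by
  obtain ⟨x, y, hx, hy, hxy⟩ := A.f0_edge U hU
  have hne : A.f0 x - A.f0 y ≠ 0 := sub_ne_zero.2 hxy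
  refine ⟨(A.f0 x - A.f0 y)⁻¹ • (x - y), ⟨fun j hj => ?_, ?_⟩, ?_⟩
  · have := A.f_eq j x y
    rw [hx j hj, hy j hj] at this
    rw [map_smul, show A.l j (x - y) = 0 by linarith, smul_zero]
  · rw [map_smul, map_sub, smul_eq_mul, inv_mul_cancel₀ hne]
  · suffices H : ∀ e e' : Fin k → ℝ, ((∀ j ∈ U, A.l j e = 0) ∧ A.f0 e = 1) →
        ((∀ j ∈ U, A.l j e' = 0) ∧ A.f0 e' = 1) → e = e' by
      intro e he
      refine H _ _ he ⟨fun j hj => ?_, ?_⟩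
      · have := A.f_eq j x y
        rw [hx j hj, hy j hj] at this
        rw [map_smul, show A.l j (x - y) = 0 by linarith, smul_zero]
      · rw [map_smul, map_sub, smul_eq_mul, inv_mul_cancel₀ hne]
    intro e e' he he'
    have hcard : U.card < (Finset.univ : Finset (Fin N)).card := by
      have := A.le_card
      simp only [Finset.card_univ, Fintype.card_fin]; omega
    obtain ⟨j, -, hj⟩ := Finset.exists_mem_notMem_of_card_lt_card hcard
    let X : ArrVertex k N := ⟨insert j U, by rw [Finset.card_insert_of_notMem hj, hU]⟩
    have key : A.l j e' • e - A.l j e • e' = 0 := by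
      apply A.eq_zero_of_l X
      intro i hi
      rcases Finset.mem_insert.1 hi with rfl | hi
      · simp only [map_sub, map_smul, smul_eq_mul]; ring
      · simp [he.1 i hi, he'.1 i hi]
    have h0 := congrArg A.f0 key
    simp only [map_sub, map_smul, he.2, he'.2, smul_eq_mul, mul_one, map_zero] at h0
    have hl : A.l j e = A.l j e' := by linarith
    have : e - e' = 0 := by
      apply A.eq_zero_of_l X
      intro i hi
      rcases Finset.mem_insert.1 hi with rfl | hi
      · simp [hl]
      · simp [he.1 i hi, he'.1 i hi]
    exact sub_eq_zero.1 this

theorem edgeVec_spec (U : Finset (Fin N)) (hU : U.card + 1 = k) :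
    (∀ j ∈ U, A.l j (A.edgeVec U) = 0) ∧ A.f0 (A.edgeVec U) = 1 :=
  Classical.epsilon_spec (A.existsUnique_edgeVec U hU).exists

/-- The open cone `C_X^+ = {X + ∑_{j ∈ X} a_j e_{X∖{j}} : a_j > 0}`. -/
def cone (X : ArrVertex k N) : Set (Fin k → ℝ) :=
  {x | ∃ a : Fin N → ℝ, (∀ j ∈ X.1, 0 < a j) ∧
    x = A.point X + ∑ j ∈ X.1, a j • A.edgeVec (X.1.erase j)}

/-- The map `x ↦ X + ρ (x - X)`; it sends `C_X^+` onto the cone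
`C_X^ρ = {X + ρ ∑_{j ∈ X} a_j e_{X∖{j}}} ⊂ ℂ^k`. -/
def rot (X : ArrVertex k N) (ρ : ℂ) (x : Fin k → ℝ) : Fin k → ℂ :=
  fun i => (A.point X i : ℂ) + ρ * ((x i - A.point X i : ℝ) : ℂ)

/-- The sign of `f_j` on `Δ_X`, the arrangement domain (connected component of the complement of
the hyperplanes) that has the vertex `X` in its boundary and on which `f₀ > f₀(X)`:
close to `X` this domain coincides with the cone `C_X^+`. -/
def domainSign (X : ArrVertex k N) (j : Fin N) : ℝ :=
  if j ∈ X.1 then Real.sign (A.l j (A.edgeVec (X.1.erase j))) else Real.sign (A.f j (A.point X))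

/-- The domain `Δ_X`, by the signs of the forms `f_j` on it. -/
def domain (X : ArrVertex k N) : Set (Fin k → ℝ) := {x | ∀ j, 0 < A.domainSign X j * A.f j x}

theorem l_edge_ne (X : ArrVertex k N) {j : Fin N} (hj : j ∈ X.1) :
    A.l j (A.edgeVec (X.1.erase j)) ≠ 0 := by
  intro h0
  have hs := A.edgeVec_spec (X.1.erase j) (by rw [Finset.card_erase_add_one hj, X.2])
  have : A.edgeVec (X.1.erase j) = 0 := by
    apply A.eq_zero_of_l X
    intro i hi
    by_cases hij : i = j
    · rw [hij, h0]
    · exact hs.1 i (Finset.mem_erase.2 ⟨hij, hi⟩)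
  rw [this] at hs
  simp at hs

theorem f_point_ne (X : ArrVertex k N) {j : Fin N} (hj : j ∉ X.1) : A.f j (A.point X) ≠ 0 := by
  intro h0
  refine A.inter_empty (insert j X.1) (by rw [Finset.card_insert_of_notMem hj, X.2])
    ⟨A.point X, fun i hi => ?_⟩
  rcases Finset.mem_insert.1 hi with rfl | hi
  · exact h0
  · exact A.point_spec X hi

theorem l_sum_edge (X : ArrVertex k N) (a : Fin N → ℝ) {i : Fin N} (hi : i ∈ X.1) :
    A.l i (∑ j ∈ X.1, a j • A.edgeVec (X.1.erase j)) =
      a i * A.l i (A.edgeVec (X.1.erase i)) := by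
  rw [map_sum, Finset.sum_eq_single i]
  · simp
  · intro j hj hji
    rw [map_smul, (A.edgeVec_spec (X.1.erase j) (by rw [Finset.card_erase_add_one hj, X.2])).1 i
      (Finset.mem_erase.2 ⟨hji.symm, hi⟩), smul_zero]
  · exact fun h => absurd hi h

theorem f0_sum_edge (X : ArrVertex k N) (a : Fin N → ℝ) :
    A.f0 (∑ j ∈ X.1, a j • A.edgeVec (X.1.erase j)) = ∑ j ∈ X.1, a j := by
  rw [map_sum]
  refine Finset.sum_congr rfl fun j hj => ?_
  rw [map_smul, (A.edgeVec_spec (X.1.erase j) (by rw [Finset.card_erase_add_one hj, X.2])).2]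
  simp

theorem sub_point_eq (X : ArrVertex k N) (x : Fin k → ℝ) :
    x - A.point X = ∑ j ∈ X.1,
      (A.f j x / A.l j (A.edgeVec (X.1.erase j))) • A.edgeVec (X.1.erase j) := by
  rw [← sub_eq_zero]
  apply A.eq_zero_of_l X
  intro i hi
  rw [map_sub, A.l_sum_edge X _ hi, div_mul_cancel₀ _ (A.l_edge_ne X hi),
    A.f_eq i x (A.point X), A.point_spec X hi]
  ring

theorem sign_mul_pos {a b : ℝ} : 0 < Real.sign a * b ↔ 0 < a * b := by
  rcases lt_trichotomy a 0 with h | h | h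
  · rw [Real.sign_of_neg h]
    constructor
    · intro hb; exact mul_pos_of_neg_of_neg h (by linarith)
    · intro hb; by_contra hc; nlinarith [mul_nonneg_of_nonpos_of_nonpos h.le (by linarith : -b ≤ 0)]
  · simp [h]
  · rw [Real.sign_of_pos h, one_mul]
    exact (mul_pos_iff_of_pos_left h).symm

theorem continuous_f (j : Fin N) : Continuous (A.f j) := (A.f j).continuous_of_finiteDimensional

/-- A component of the complement of the hyperplanes is given by the signs of the `f_j`. -/
theorem component_eq (x : Fin k → ℝ) (hx : ∀ j, A.f j x ≠ 0) :
    connectedComponentIn {y | ∀ j, A.f j y ≠ 0} x = {y | ∀ j, 0 < A.f j x * A.f j y} := by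
  apply Set.Subset.antisymm
  · intro y hy j
    by_contra hneg
    have hpre : IsPreconnected (connectedComponentIn {y | ∀ j, A.f j y ≠ 0} x) :=
      isPreconnected_connectedComponentIn
    have hxm := mem_connectedComponentIn (F := {y | ∀ j, A.f j y ≠ 0}) (x := x) hx
    have hc : ContinuousOn (fun y => A.f j x * A.f j y)
        (connectedComponentIn {y | ∀ j, A.f j y ≠ 0} x) :=
      (continuous_const.mul (A.continuous_f j)).continuousOn
    obtain ⟨z, hz, hz0⟩ := hpre.intermediate_value hy hxm hc
      (show (0 : ℝ) ∈ _ from ⟨not_lt.1 hneg, mul_self_nonneg _⟩)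
    have hz1 := connectedComponentIn_subset _ _ hz j
    exact (mul_ne_zero (hx j) hz1) hz0
  · have hconv : Convex ℝ {y | ∀ j, 0 < A.f j x * A.f j y} := by
      intro y hy z hz a b ha hb hab j
      have : A.f j (a • y + b • z) = a * A.f j y + b * A.f j z := by
        rw [Convex.combo_affine_apply hab]; simp
      rw [this]
      have h1 := hy j
      have h2 := hz j
      rcases ha.eq_or_lt with rfl | ha
      · have hb1 : b = 1 := by linarith
        subst hb1; linarith
      · have := mul_pos ha h1
        have := mul_nonneg hb h2.le
        nlinarith
    exact hconv.isPreconnected.subset_connectedComponentIn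
      (fun j => mul_self_pos.2 (hx j)) (fun y hy j => right_ne_zero_of_mul (hy j).ne')

/-- A point close to `X` in the direction `∑ a_j e_{X∖{j}}`: signs of the `f_j`. -/
theorem near_point (X : ArrVertex k N) (a : Fin N → ℝ) :
    ∀ᶠ t : ℝ in 𝓝[>] 0,
      (∀ j ∈ X.1, A.f j (A.point X + t • ∑ i ∈ X.1, a i • A.edgeVec (X.1.erase i)) =
        t * (a j * A.l j (A.edgeVec (X.1.erase j)))) ∧
      (∀ j ∉ X.1, 0 < A.f j (A.point X) *
        A.f j (A.point X + t • ∑ i ∈ X.1, a i • A.edgeVec (X.1.erase i))) := by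
  refine Filter.Eventually.and (Filter.Eventually.of_forall fun t j hj => ?_) ?_
  · rw [A.f_eq j _ (A.point X), A.point_spec X hj, add_sub_cancel_left, map_smul,
      A.l_sum_edge X a hj]
    simp
  · apply nhdsWithin_le_nhds
    refine Filter.eventually_all.2 fun j => ?_
    by_cases hj : j ∈ X.1
    · exact Filter.Eventually.of_forall fun t h => absurd hj h
    · have hc : Continuous fun t : ℝ => A.f j (A.point X) *
          A.f j (A.point X + t • ∑ i ∈ X.1, a i • A.edgeVec (X.1.erase i)) :=
        continuous_const.mul ((A.continuous_f j).comp (by fun_prop))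
      have := hc.continuousAt.eventually_mem (x := 0)
        (isOpen_Ioi.mem_nhds (show (0 : ℝ) < _ by
          simpa using A.f_point_ne X hj))
      exact this.mono fun t ht _ => ht

/-- `domain X` is the only arrangement domain `Δ` with `X` in its boundary on which
`f₀ > f₀(X)`. -/
theorem eq_domain_iff (X : ArrVertex k N) (Δ : Set (Fin k → ℝ)) :
    ((∃ x, (∀ j, A.f j x ≠ 0) ∧ Δ = connectedComponentIn {y | ∀ j, A.f j y ≠ 0} x) ∧
      A.point X ∈ closure Δ ∧ ∀ x ∈ Δ, A.f0 (A.point X) < A.f0 x) ↔ Δ = A.domain X := by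
  have hf0 : ∀ x, A.f0 x - A.f0 (A.point X) =
      ∑ j ∈ X.1, A.f j x / A.l j (A.edgeVec (X.1.erase j)) := fun x => by
    rw [← map_sub, A.sub_point_eq X x, A.f0_sum_edge]
  have hdom : ∀ x, x ∈ A.domain X ↔
      (∀ j ∈ X.1, 0 < A.l j (A.edgeVec (X.1.erase j)) * A.f j x) ∧
      ∀ j ∉ X.1, 0 < A.f j (A.point X) * A.f j x := by
    intro x
    constructor
    · intro h
      refine ⟨fun j hj => ?_, fun j hj => ?_⟩
      · have := h j
        rw [domainSign, if_pos hj, sign_mul_pos] at this; exact this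
      · have := h j
        rw [domainSign, if_neg hj, sign_mul_pos] at this; exact this
    · rintro ⟨h1, h2⟩ j
      rw [domainSign]
      split_ifs with hj
      · exact sign_mul_pos.2 (h1 j hj)
      · exact sign_mul_pos.2 (h2 j hj)
  have hcell : ∀ x ∈ A.domain X, (∀ j, A.f j x ≠ 0) ∧
      connectedComponentIn {y | ∀ j, A.f j y ≠ 0} x = A.domain X := by
    intro x hx
    have hne : ∀ j, A.f j x ≠ 0 := fun j => right_ne_zero_of_mul (hx j).ne'
    refine ⟨hne, ?_⟩
    rw [A.component_eq x hne]
    ext y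
    refine forall_congr' fun j => ?_
    have h1 : 0 < A.domainSign X j * A.f j x := hx j
    constructor
    · intro h2
      have h3 := mul_pos h1 h2
      have : 0 < (A.f j x) ^ 2 * (A.domainSign X j * A.f j y) := by nlinarith
      exact (mul_pos_iff_of_pos_left (by have := hne j; positivity)).1 this
    · intro h2
      have h3 := mul_pos h1 h2
      have : 0 < (A.domainSign X j) ^ 2 * (A.f j x * A.f j y) := by nlinarith
      have h0 : A.domainSign X j ≠ 0 := left_ne_zero_of_mul h1.ne'
      exact (mul_pos_iff_of_pos_left (by positivity)).1 this
  constructor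
  · rintro ⟨⟨x0, hx0, rfl⟩, hcl, hpos⟩
    suffices hmem : x0 ∈ A.domain X from (hcell x0 hmem).2
    rw [A.component_eq x0 hx0] at hcl hpos
    have hout : ∀ j ∉ X.1, 0 < A.f j (A.point X) * A.f j x0 := by
      intro j hj
      have hopen : IsOpen {y | 0 < A.f j (A.point X) * A.f j y} :=
        isOpen_Ioi.preimage (continuous_const.mul (A.continuous_f j))
      obtain ⟨y, hy1, hy2⟩ := mem_closure_iff.1 hcl _ hopen
        (mul_self_pos.2 (A.f_point_ne X hj))
      have h2 : 0 < A.f j x0 * A.f j y := hy2 j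
      have h1 : 0 < A.f j (A.point X) * A.f j y := hy1
      have : 0 < (A.f j y) ^ 2 * (A.f j (A.point X) * A.f j x0) := by
        have := mul_pos h1 h2; nlinarith
      exact (mul_pos_iff_of_pos_left (by
        have := right_ne_zero_of_mul h2.ne'; positivity)).1 this
    refine (hdom x0).2 ⟨fun j hj => ?_, hout⟩
    by_contra hneg
    set b : Fin N → ℝ := fun i => A.f i x0 / A.l i (A.edgeVec (X.1.erase i)) with hb
    have hbj : b j < 0 := by
      have hle := A.l_edge_ne X hj
      have h1 : A.l j (A.edgeVec (X.1.erase j)) * A.f j x0 < 0 :=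
        lt_of_le_of_ne (not_lt.1 hneg) (mul_ne_zero hle (hx0 j))
      have h2 : b j = (A.l j (A.edgeVec (X.1.erase j)) * A.f j x0) /
          (A.l j (A.edgeVec (X.1.erase j))) ^ 2 := by
        simp only [hb]; field_simp
      rw [h2]
      exact div_neg_of_neg_of_pos h1 (by positivity)
    obtain ⟨M, hM1, hM⟩ : ∃ M : ℝ, 1 ≤ M ∧ M * b j + ∑ i ∈ X.1.erase j, b i < 0 := by
      refine ⟨1 + |∑ i ∈ X.1.erase j, b i| / (- b j), ?_, ?_⟩
      · have : 0 ≤ |∑ i ∈ X.1.erase j, b i| / (- b j) :=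
          div_nonneg (abs_nonneg _) (by linarith)
        linarith
      · have h1 : (1 + |∑ i ∈ X.1.erase j, b i| / (- b j)) * b j =
            b j - |∑ i ∈ X.1.erase j, b i| := by
          have hb0 := hbj.ne
          rw [add_mul, one_mul, div_neg, neg_mul, div_mul_cancel₀ _ hb0]; ring
        have := le_abs_self (∑ i ∈ X.1.erase j, b i)
        rw [h1]; linarith
    set a : Fin N → ℝ := fun i => (if i = j then M else 1) * b i with ha
    obtain ⟨t, ⟨h1, h2⟩, ht⟩ :=
      ((A.near_point X a).and self_mem_nhdsWithin).exists
    have ht : 0 < t := ht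
    have hy : A.point X + t • ∑ i ∈ X.1, a i • A.edgeVec (X.1.erase i) ∈
        {y | ∀ j, 0 < A.f j x0 * A.f j y} := by
      intro i
      by_cases hi : i ∈ X.1
      · rw [h1 i hi]
        have hfi : a i * A.l i (A.edgeVec (X.1.erase i)) = (if i = j then M else 1) * A.f i x0 := by
          have := A.l_edge_ne X hi
          simp only [ha, hb]; field_simp
        rw [hfi]
        have hc : 0 < (if i = j then M else 1 : ℝ) := by split_ifs <;> linarith
        have hsq := mul_self_pos.2 (hx0 i)
        have := mul_pos (mul_pos ht hc) hsq
        nlinarith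
      · have h3 := mul_pos (hout i hi) (h2 i hi)
        have : 0 < (A.f i (A.point X)) ^ 2 * (A.f i x0 *
            A.f i (A.point X + t • ∑ i ∈ X.1, a i • A.edgeVec (X.1.erase i))) := by
          nlinarith
        exact (mul_pos_iff_of_pos_left (by have := A.f_point_ne X hi; positivity)).1 this
    have h3 := hpos _ hy
    rw [map_add, map_smul, A.f0_sum_edge, ← Finset.add_sum_erase _ _ hj] at h3
    have h4 : ∑ i ∈ X.1.erase j, a i = ∑ i ∈ X.1.erase j, b i :=
      Finset.sum_congr rfl fun i hi => by simp [ha, Finset.ne_of_mem_erase hi]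
    have h5 : a j = M * b j := by simp [ha]
    rw [h4, h5, smul_eq_mul] at h3
    have := mul_neg_of_pos_of_neg ht hM
    linarith
  · rintro rfl
    have hnear : ∀ᶠ t : ℝ in 𝓝[>] 0,
        A.point X + t • ∑ i ∈ X.1, (1 : ℝ) • A.edgeVec (X.1.erase i) ∈ A.domain X := by
      filter_upwards [A.near_point X (fun _ => 1), self_mem_nhdsWithin] with t h ht
      refine (hdom _).2 ⟨fun j hj => ?_, h.2⟩
      rw [h.1 j hj]
      have ht : 0 < t := ht
      have := mul_pos ht (mul_self_pos.2 (A.l_edge_ne X hj))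
      nlinarith
    refine ⟨?_, ?_, ?_⟩
    · obtain ⟨t, ht⟩ := hnear.exists
      exact ⟨_, (hcell _ ht).1, (hcell _ ht).2.symm⟩
    · refine mem_closure_of_tendsto (f := fun t : ℝ =>
        A.point X + t • ∑ i ∈ X.1, (1 : ℝ) • A.edgeVec (X.1.erase i)) ?_ hnear
      have hc : Continuous fun t : ℝ =>
          A.point X + t • ∑ i ∈ X.1, (1 : ℝ) • A.edgeVec (X.1.erase i) := by fun_prop
      have := (hc.tendsto 0).mono_left (nhdsWithin_le_nhds (s := Set.Ioi 0))
      simpa using this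
    · intro x hx
      have hne : X.1.Nonempty := by
        rw [← Finset.card_pos, X.2]; exact A.one_le
      have := hf0 x
      have hs : 0 < ∑ j ∈ X.1, A.f j x / A.l j (A.edgeVec (X.1.erase j)) := by
        refine Finset.sum_pos (fun j hj => ?_) hne
        have h1 := ((hdom x).1 hx).1 j hj
        have hle := A.l_edge_ne X hj
        have h2 : A.f j x / A.l j (A.edgeVec (X.1.erase j)) =
            (A.l j (A.edgeVec (X.1.erase j)) * A.f j x) /
              (A.l j (A.edgeVec (X.1.erase j))) ^ 2 := by field_simp
        rw [h2]; positivity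
      linarith

/-- The branch of `∏_j |f_j|^{α_j}` that is real positive on `Δ_X`: there
`|f_j| = domainSign X j * f_j`. The principal powers are analytic on the open set of all `z`
for which no `domainSign X j * f_j z` lies in `(-∞, 0]`; this set is star-shaped with respect to
each point of `Δ_X`, does not meet the complex hyperplanes, and contains `Δ_X` and all the cones
`C_X^ρ`, `ρ ∉ ℝ`. So on the cones this is the analytic extension of the real branch on `Δ_X`. -/
def branch (α : Fin N → ℝ) (X : ArrVertex k N) (z : Fin k → ℂ) : ℂ :=
  ∏ j, ((A.domainSign X j : ℂ) * complexifyForm (A.f j) z) ^ (α j : ℂ)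

/-- The open set of `ℂ^k` on which all `domainSign X j * f_j` avoid `(-∞, 0]`. -/
def branchDomain (X : ArrVertex k N) : Set (Fin k → ℂ) :=
  {z | ∀ j, (A.domainSign X j : ℂ) * complexifyForm (A.f j) z ∈ Complex.slitPlane}

theorem complexifyForm_ofReal (g : (Fin k → ℝ) →ᵃ[ℝ] ℝ) (x : Fin k → ℝ) :
    complexifyForm g (fun i => (x i : ℂ)) = (g x : ℂ) := by
  have : (fun i : Fin k => ((x i : ℂ)).im) = 0 := by ext; simp
  simp only [complexifyForm, this, map_zero]
  simp

theorem complexifyForm_eq (g : (Fin k → ℝ) →ᵃ[ℝ] ℝ) (z : Fin k → ℂ) :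
    complexifyForm g z = (g 0 : ℂ) + ∑ i, (g.linear (Pi.single i 1) : ℂ) * z i := by
  have h1 : ∀ v : Fin k → ℝ, g.linear v = ∑ i, g.linear (Pi.single i 1) * v i := by
    intro v
    conv_lhs => rw [← Finset.univ_sum_single v]
    rw [map_sum]
    refine Finset.sum_congr rfl fun i _ => ?_
    rw [mul_comm, ← smul_eq_mul, ← map_smul, ← Pi.single_smul]; simp
  have h2 : ∀ v : Fin k → ℝ, g v = g 0 + g.linear v := by
    intro v
    have := g.linearMap_vsub v 0
    simp only [vsub_eq_sub, sub_zero] at this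
    linarith
  rw [complexifyForm, h2, h1, h1]
  push_cast
  rw [add_assoc, Finset.mul_sum, ← Finset.sum_add_distrib]
  congr 1
  refine Finset.sum_congr rfl fun i _ => ?_
  conv_rhs => rw [← Complex.re_add_im (z i)]
  ring

theorem complexifyForm_rot (X : ArrVertex k N) (ρ : ℂ) (x : Fin k → ℝ) (j : Fin N) :
    complexifyForm (A.f j) (A.rot X ρ x) =
      (A.f j (A.point X) : ℂ) + ρ * (A.l j (x - A.point X) : ℂ) := by
  have h := complexifyForm_eq (A.f j) (A.rot X ρ x)
  have h1 := complexifyForm_eq (A.f j) (fun i => (A.point X i : ℂ))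
  have h2 := complexifyForm_eq (A.f j) (fun i => (x i : ℂ))
  rw [complexifyForm_ofReal] at h1 h2
  have h3 := congrArg (fun r : ℝ => (r : ℂ)) (A.f_eq j x (A.point X))
  push_cast at h3
  rw [h]
  have h4 : (A.l j (x - A.point X) : ℂ) = A.f j x - A.f j (A.point X) := by
    rw [h3]; ring
  rw [h4, h2, h1]
  simp only [rot]
  push_cast
  simp only [mul_add, mul_sub, Finset.sum_add_distrib, Finset.mul_sum, Finset.sum_sub_distrib]
  have : ∀ i, ((A.f j).linear (Pi.single i 1) : ℂ) * (ρ * (x i : ℂ)) =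
      ρ * (((A.f j).linear (Pi.single i 1) : ℂ) * (x i : ℂ)) := fun i => by ring
  have h' : ∀ i, ((A.f j).linear (Pi.single i 1) : ℂ) * (ρ * (A.point X i : ℂ)) =
      ρ * (((A.f j).linear (Pi.single i 1) : ℂ) * (A.point X i : ℂ)) := fun i => by ring
  simp only [this, h']
  ring

/-- `branch` is the analytic extension from `Δ_X` to the cones `C_X^ρ` of the real branch of
`∏_j |f_j|^{α_j}`: it is holomorphic on an open set which is star-shaped about the points of `Δ_X`,
does not meet the complex hyperplanes, contains `Δ_X` and the cones `C_X^ρ`, `ρ ∉ ℝ`, and it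
takes the real values on `Δ_X`. -/
theorem branch_spec (α : Fin N → ℝ) (X : ArrVertex k N) :
    IsOpen (A.branchDomain X) ∧
    (∀ x ∈ A.domain X, StarConvex ℝ (fun i => (x i : ℂ)) (A.branchDomain X)) ∧
    (∀ z ∈ A.branchDomain X, ∀ j, complexifyForm (A.f j) z ≠ 0) ∧
    (∀ x ∈ A.domain X, (fun i => (x i : ℂ)) ∈ A.branchDomain X) ∧
    (∀ ρ : ℂ, ρ.im ≠ 0 → ∀ x ∈ A.cone X, A.rot X ρ x ∈ A.branchDomain X) ∧
    DifferentiableOn ℂ (A.branch α X) (A.branchDomain X) ∧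
    (∀ x ∈ A.domain X, A.branch α X (fun i => (x i : ℂ)) =
      ((∏ j, |A.f j x| ^ α j : ℝ) : ℂ)) := by
  have hdiff : ∀ j, Differentiable ℂ (complexifyForm (A.f j)) := by
    intro j
    rw [show complexifyForm (A.f j) = fun z => _ from funext (complexifyForm_eq (A.f j))]
    fun_prop
  have hreal : ∀ x ∈ A.domain X, ∀ j,
      (A.domainSign X j : ℂ) * complexifyForm (A.f j) (fun i => (x i : ℂ)) =
        ((A.domainSign X j * A.f j x : ℝ) : ℂ) := by
    intro x _ j
    rw [complexifyForm_ofReal]; push_cast; rfl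
  have hsgn : ∀ j, |A.domainSign X j| = 1 := by
    have hs : ∀ a : ℝ, a ≠ 0 → |Real.sign a| = 1 := by
      intro a ha
      rcases lt_or_gt_of_ne ha with h | h
      · simp [Real.sign_of_neg h]
      · simp [Real.sign_of_pos h]
    intro j
    rw [domainSign]
    split_ifs with hj
    · exact hs _ (A.l_edge_ne X hj)
    · exact hs _ (A.f_point_ne X hj)
  have hmem : ∀ x ∈ A.domain X, (fun i => (x i : ℂ)) ∈ A.branchDomain X := by
    intro x hx j
    rw [hreal x hx j]
    exact Complex.ofReal_mem_slitPlane.2 (hx j)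
  refine ⟨?_, ?_, ?_, hmem, ?_, ?_, ?_⟩
  · rw [branchDomain, Set.ofPred_forall]
    exact isOpen_iInter_of_finite fun j => Complex.isOpen_slitPlane.preimage
      (continuous_const.mul (hdiff j).continuous)
  · intro x hx z hz a b ha hb hab j
    have h1 : (A.domainSign X j : ℂ) *
        complexifyForm (A.f j) (a • (fun i => (x i : ℂ)) + b • z) =
        a * ((A.domainSign X j : ℂ) * complexifyForm (A.f j) (fun i => (x i : ℂ))) +
        b * ((A.domainSign X j : ℂ) * complexifyForm (A.f j) z) := by
      have hab' : (a : ℂ) + b = 1 := by exact_mod_cast hab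
      simp only [complexifyForm_eq, Pi.add_apply, Pi.smul_apply, Complex.real_smul, mul_add,
        Finset.sum_add_distrib, Finset.mul_sum]
      have e1 : ∀ i, (A.domainSign X j : ℂ) *
          (((A.f j).linear (Pi.single i 1) : ℂ) * ((a : ℂ) * (x i : ℂ))) =
          (a : ℂ) * ((A.domainSign X j : ℂ) *
          (((A.f j).linear (Pi.single i 1) : ℂ) * (x i : ℂ))) := fun i => by ring
      have e2 : ∀ i, (A.domainSign X j : ℂ) *
          (((A.f j).linear (Pi.single i 1) : ℂ) * ((b : ℂ) * z i)) =
          (b : ℂ) * ((A.domainSign X j : ℂ) *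
          (((A.f j).linear (Pi.single i 1) : ℂ) * z i)) := fun i => by ring
      simp only [e1, e2]
      linear_combination (-((A.domainSign X j : ℂ) * ((A.f j 0 : ℝ) : ℂ))) * hab'
    rw [h1, hreal x hx j]
    have hp := hx j
    have hq := hz j
    rw [Complex.mem_slitPlane_iff] at hq ⊢
    rcases hb.eq_or_lt with rfl | hb
    · left
      have : a = 1 := by linarith
      subst this
      simpa using hp
    · rcases hq with hq | hq
      · left
        have e : ((a : ℂ) * ((A.domainSign X j * A.f j x : ℝ) : ℂ) +
            b * ((A.domainSign X j : ℂ) * complexifyForm (A.f j) z)).re =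
            a * (A.domainSign X j * A.f j x) +
            b * ((A.domainSign X j : ℂ) * complexifyForm (A.f j) z).re := by
          rw [Complex.add_re, Complex.re_ofReal_mul, Complex.re_ofReal_mul, Complex.ofReal_re]
        rw [e]
        have := mul_pos hb hq
        have := mul_nonneg ha hp.le
        linarith
      · right
        have e : ((a : ℂ) * ((A.domainSign X j * A.f j x : ℝ) : ℂ) +
            b * ((A.domainSign X j : ℂ) * complexifyForm (A.f j) z)).im =
            b * ((A.domainSign X j : ℂ) * complexifyForm (A.f j) z).im := by
          rw [Complex.add_im, Complex.im_ofReal_mul, Complex.im_ofReal_mul, Complex.ofReal_im]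
          ring
        rw [e]
        exact mul_ne_zero hb.ne' hq
  · intro z hz j h0
    have := hz j
    rw [h0, mul_zero] at this
    exact Complex.zero_notMem_slitPlane this
  · rintro ρ hρ x ⟨a, ha, rfl⟩ j
    rw [A.complexifyForm_rot, add_sub_cancel_left, Complex.mem_slitPlane_iff]
    by_cases hj : j ∈ X.1
    · right
      rw [A.point_spec X hj, A.l_sum_edge X a hj, domainSign, if_pos hj]
      have h0 : Real.sign (A.l j (A.edgeVec (X.1.erase j))) ≠ 0 := by
        rw [Ne, Real.sign_eq_zero_iff]; exact A.l_edge_ne X hj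
      rw [Complex.im_ofReal_mul, Complex.ofReal_zero, zero_add, Complex.im_mul_ofReal]
      exact mul_ne_zero h0 (mul_ne_zero hρ (mul_ne_zero (ha j hj).ne' (A.l_edge_ne X hj)))
    · set v := A.l j (∑ j ∈ X.1, a j • A.edgeVec (X.1.erase j))
      by_cases hv : v = 0
      · left
        rw [hv, domainSign, if_neg hj]
        simp only [Complex.ofReal_zero, mul_zero, add_zero]
        rw [Complex.re_ofReal_mul, Complex.ofReal_re]
        exact sign_mul_pos.2 (mul_self_pos.2 (A.f_point_ne X hj))
      · right
        rw [Complex.im_ofReal_mul, Complex.add_im, Complex.ofReal_im, zero_add,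
          Complex.im_mul_ofReal]
        refine mul_ne_zero ?_ (mul_ne_zero hρ hv)
        have := hsgn j
        intro h; rw [h] at this; simp at this
  · intro z hz
    refine DifferentiableAt.differentiableWithinAt ?_
    unfold branch
    have hd : ∀ j, DifferentiableAt ℂ (fun z : Fin k → ℂ =>
        ((A.domainSign X j : ℂ) * complexifyForm (A.f j) z) ^ (α j : ℂ)) z := fun j =>
      ((hdiff j z).const_mul (A.domainSign X j : ℂ)).cpow_const (hz j)
    exact (HasFDerivAt.finsetProd (fun j _ => (hd j).hasFDerivAt)).differentiableAt
  · intro x hx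
    unfold branch
    push_cast
    refine Finset.prod_congr rfl fun j _ => ?_
    rw [hreal x hx j, ← Complex.ofReal_cpow (hx j).le]
    congr 2
    have h1 : |A.domainSign X j * A.f j x| = |A.f j x| := by
      rw [abs_mul, hsgn j, one_mul]
    rw [← h1, abs_of_pos (hx j)]

/-- The coefficient of `ω_X = df_{j_1}/f_{j_1} ∧ ⋯ ∧ df_{j_k}/f_{j_k}` with respect to
`dz_1 ∧ ⋯ ∧ dz_k`. Since `j_1, …, j_k` are ordered so that `df_{j_1} ∧ ⋯ ∧ df_{j_k}` is positively
oriented, the determinant of the coefficients of the `df_j` enters by its absolute value. -/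
def omega (X : ArrVertex k N) (z : Fin k → ℂ) : ℂ :=
  ((|(Matrix.of fun a b : Fin k =>
      A.l (X.1.orderEmbOfFin X.2 a) (Pi.single b (1 : ℝ))).det| : ℝ) : ℂ) /
    ∏ j ∈ X.1, complexifyForm (A.f j) z

/-- The integrand of `∫_{C_X^ρ} e^{-λ f₀} Ω_{X'}`, `Ω_{X'} = (∏_j |f_j|^{α_j}) ω_{X'}`, pulled back
to `C_X^+` by `x ↦ X + ρ (x - X)`; the factor `ρ ^ k` is the Jacobian. -/
def integrand (α : Fin N → ℝ) (ρ : ℂ) (X X' : ArrVertex k N) (lam : ℂ) (x : Fin k → ℝ) : ℂ :=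
  Complex.exp (-lam * complexifyForm A.f0.toAffineMap (A.rot X ρ x)) *
    A.branch α X (A.rot X ρ x) * A.omega X' (A.rot X ρ x) * ρ ^ k

/-- `I^ρ_{X,X'}(λ) = ∫_{C_X^ρ} e^{-λ f₀} Ω_{X'}`. -/
def rhoIntegral (α : Fin N → ℝ) (ρ : ℂ) (X X' : ArrVertex k N) (lam : ℂ) : ℂ :=
  ∫ x in A.cone X, A.integrand α ρ X X' lam x

/-- The directions `ρ` used for `I^±_X(λ)`, where `σ = ±1`:
`|ρ| = 1`, `∓ Im ρ > 0` and `Re (ρ λ) > 0`. -/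
def Admissible (σ : ℝ) (lam ρ : ℂ) : Prop :=
  ‖ρ‖ = 1 ∧ σ * ρ.im < 0 ∧ 0 < (ρ * lam).re

/-- `I^±_{X,X'}(λ)` (`σ = ±1`): the common value of the `I^ρ_{X,X'}(λ)` over admissible `ρ`;
as a function of `X'` this is the vector `I^±_X(λ)`. -/
def solution (α : Fin N → ℝ) (σ : ℝ) (X : ArrVertex k N) (lam : ℂ) : ArrVertex k N → ℂ :=
  fun X' => Classical.epsilon fun c : ℂ =>
    ∀ ρ, Admissible σ lam ρ → A.rhoIntegral α ρ X X' lam = c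

/-- The diagonal matrix with entries `f₀(X)`. -/
def matA : Matrix (ArrVertex k N) (ArrVertex k N) ℂ :=
  Matrix.diagonal fun X => (A.f0 (A.point X) : ℂ)

/-- The residue matrix: `α_X` on the diagonal, `sgn (l_j(e_U) l_r(e_U)) α_r` if `U = X ∩ Y` has
`k - 1` elements, `X ∖ Y = {j}` and `Y ∖ X = {r}`, and `0` otherwise. -/
def matB (α : Fin N → ℝ) : Matrix (ArrVertex k N) (ArrVertex k N) ℂ :=
  Matrix.of fun X Y =>
    if X = Y then (weight α X.1 : ℂ)
    else if (X.1 ∩ Y.1).card + 1 = k then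
      ∑ j ∈ X.1 \ Y.1, ∑ r ∈ Y.1 \ X.1,
        ((Real.sign (A.l j (A.edgeVec (X.1 ∩ Y.1)) * A.l r (A.edgeVec (X.1 ∩ Y.1))) * α r : ℝ) : ℂ)
    else 0

/-- `D_{X,X} = ∏_{j∈X} Γ(α_j) · ∏_{j∈X} |l_j(e_{X∖{j}})|^{α_j} · ∏_{j∉X} |f_j(X)|^{α_j}`. -/
def constD (α : Fin N → ℝ) (X : ArrVertex k N) : ℝ :=
  (∏ j ∈ X.1, Real.Gamma (α j)) * (∏ j ∈ X.1, |A.l j (A.edgeVec (X.1.erase j))| ^ α j) *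
    ∏ j ∈ X.1ᶜ, |A.f j (A.point X)| ^ α j

/-- `∏_{j∈X} sgn l_j(e_{X∖{j}})`, the sign of `∏_{j∈X} f_j` on `C_X^+`, i.e. the sign of the form
`ω_X` there. -/
def coneSign (X : ArrVertex k N) : ℝ :=
  ∏ j ∈ X.1, Real.sign (A.l j (A.edgeVec (X.1.erase j)))

end GenericArrangement

/-- For `σ = ±1`: `ℂ ∖ i ℝ_∓`, the plane cut along the closed imaginary half-axis. -/
def slitDomain (σ : ℝ) : Set ℂ := {lam | ¬ (lam.re = 0 ∧ σ * lam.im ≤ 0)}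

/-- For `σ = ±1`: the sector `S_± = {ε - π/2 < ± arg λ < 3π/2 - ε}`. -/
def stokesSector (σ ε : ℝ) : Set ℂ :=
  {lam | ∃ r θ : ℝ, 0 < r ∧ ε - Real.pi / 2 < σ * θ ∧ σ * θ < 3 * Real.pi / 2 - ε ∧
    lam = r * Complex.exp (θ * Complex.I)}

/-- For `σ = ±1`: the branch of the logarithm on `ℂ ∖ i ℝ_∓` with
`-π/2 < ± arg λ < 3π/2`. -/
def sectorLog (σ : ℝ) (lam : ℂ) : ℂ :=
  Complex.log (-(σ * Complex.I * lam)) + σ * (Real.pi / 2) * Complex.I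

/-- The power `λ^s` defined with this branch of the logarithm. -/
def sectorPow (σ : ℝ) (lam s : ℂ) : ℂ := Complex.exp (s * sectorLog σ lam)

end

/-!
Coordinates along the edges at `X` identify the cone at `X` with the positive orthant. There the
integrand on `C_X^ρ` is, up to constants, a product of one-dimensional Gamma densities
`a ^ γ e^{-λ ρ a}` and of powers of the affine forms `q + ρ ∑ b_m a_m` with `q > 0` that come from
the hyperplanes not passing through `X`. For `Im ρ ≠ 0` these forms stay off the branch cut and have
modulus at least `q` times the sine of the angle of `ρ` with the real axis, which dominates the
integrand locally uniformly: the integral is holomorphic in `ρ` and in `λ`. Scaling the coordinates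
by `t > 0` shows that it takes the same value at `ρ` and `t ρ`, and a holomorphic function with this
property is constant on the convex set of admissible `ρ`.

For the differential equation, the derivative in `λ` brings down `-f₀`, which is the constant
`-f₀(X')` plus a linear combination of the forms `f_j`, `j ∈ X'`. Each `f_j` cancels one pole of
`Ω_{X'}`, and integrating by parts along the edge `e_{X' ∖ {j}}` turns the result into integrals
with the exchanged vertices `X' ∖ {j} ∪ {r}`, which produces `ℬ / λ`.

For the asymptotics, `ρ` is taken of modulus `|λ|⁻¹`, so that `λ ρ` has modulus `1` while the affine
forms tend to `q`. By dominated convergence the integral tends to a product of Gamma integrals, and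
every `j ∈ X ∖ X'` costs a factor `λ⁻¹`, so that only `X' = X` survives.
-/

open scoped Pointwise

noncomputable section

section ParametricIntegral

theorem aestronglyMeasurable_deriv_param {𝕜 E α : Type*} [NontriviallyNormedField 𝕜]
    [NormedAddCommGroup E] [NormedSpace 𝕜 E] [MeasurableSpace α] {ν : Measure α}
    {F : 𝕜 → α → E} {z₀ : 𝕜} (hmeas : ∀ᶠ z in 𝓝 z₀, AEStronglyMeasurable (F z) ν)
    (hdiff : ∀ᵐ a ∂ν, DifferentiableAt 𝕜 (fun z => F z a) z₀) :
    AEStronglyMeasurable (fun a => deriv (fun z => F z a) z₀) ν := by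
  obtain ⟨u, hu, hFu⟩ := exists_seq_forall_of_frequently
    (hmeas.filter_mono nhdsWithin_le_nhds : ∀ᶠ z in 𝓝[≠] z₀, _).frequently
  refine aestronglyMeasurable_of_tendsto_ae atTop
    (f := fun n a => slope (fun z => F z a) z₀ (u n)) (fun n => ?_) ?_
  · exact ((hFu n).sub hmeas.self_of_nhds).const_smul _
  · filter_upwards [hdiff] with a ha
    exact (hasDerivAt_iff_tendsto_slope.1 ha.hasDerivAt).comp hu

theorem norm_deriv_le_of_mem_half_ball {E : Type*} [NormedAddCommGroup E] [NormedSpace ℂ E]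
    {f : ℂ → E} {z₀ z : ℂ} {r C : ℝ} (hf : DifferentiableOn ℂ f (Metric.ball z₀ r))
    (hC : ∀ w ∈ Metric.ball z₀ r, ‖f w‖ ≤ C) (hz : z ∈ Metric.ball z₀ (r / 2)) :
    ‖deriv f z‖ ≤ C / (r / 4) := by
  have hr : 0 < r / 2 := Metric.pos_of_mem_ball hz
  have hsub : Metric.closedBall z (r / 4) ⊆ Metric.ball z₀ r :=
    Metric.closedBall_subset_ball' (by rw [Metric.mem_ball] at hz; linarith)
  refine Complex.norm_deriv_le_of_forall_mem_sphere_norm_le (by linarith) ?_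
    fun w hw => hC w (hsub (Metric.sphere_subset_closedBall hw))
  exact (hf.mono (Metric.closure_ball_subset_closedBall.trans hsub)).diffContOnCl

theorem hasDerivAt_integral_of_dominated_of_differentiableOn {E α : Type*}
    [NormedAddCommGroup E] [NormedSpace ℂ E] [MeasurableSpace α] {ν : Measure α}
    {F : ℂ → α → E} {z₀ : ℂ} {r : ℝ} (hr : 0 < r) {bound : α → ℝ}
    (hmeas : ∀ z ∈ Metric.ball z₀ r, AEStronglyMeasurable (F z) ν)
    (hdiff : ∀ᵐ a ∂ν, DifferentiableOn ℂ (fun z => F z a) (Metric.ball z₀ r))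
    (hbound : ∀ᵐ a ∂ν, ∀ z ∈ Metric.ball z₀ r, ‖F z a‖ ≤ bound a) (hint : Integrable bound ν) :
    HasDerivAt (fun z => ∫ a, F z a ∂ν) (∫ a, deriv (fun z => F z a) z₀ ∂ν) z₀ := by
  have hmem : z₀ ∈ Metric.ball z₀ r := Metric.mem_ball_self hr
  have hmeas' : ∀ᶠ z in 𝓝 z₀, AEStronglyMeasurable (F z) ν :=
    mem_of_superset (Metric.ball_mem_nhds z₀ hr) hmeas
  have hdiffAt : ∀ᵐ a ∂ν, ∀ z ∈ Metric.ball z₀ r, DifferentiableAt ℂ (fun z => F z a) z :=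
    hdiff.mono fun a ha z hz => ha.differentiableAt (Metric.isOpen_ball.mem_nhds hz)
  refine (hasDerivAt_integral_of_dominated_loc_of_deriv_le (s := Metric.ball z₀ (r / 2))
    (bound := fun a => bound a / (r / 4)) (F' := fun z a => deriv (fun z => F z a) z)
    (Metric.ball_mem_nhds _ (half_pos hr)) hmeas'
    (hint.mono' (hmeas _ hmem) (hbound.mono fun a ha => ha _ hmem))
    (aestronglyMeasurable_deriv_param hmeas' (hdiffAt.mono fun a ha => ha _ hmem))
    ?_ (hint.div_const _) ?_).2
  · filter_upwards [hdiff, hbound] with a ha hb z hz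
      using norm_deriv_le_of_mem_half_ball ha hb hz
  · filter_upwards [hdiffAt] with a ha z hz
    exact (ha z (Metric.ball_subset_ball (by linarith) hz)).hasDerivAt

theorem eq_of_differentiableOn_of_map_real_mul {E : Type*} [NormedAddCommGroup E]
    [NormedSpace ℂ E] {U : Set ℂ} (hU : IsOpen U) (hconv : Convex ℝ U) (h0 : (0 : ℂ) ∉ U)
    {F : ℂ → E} (hF : DifferentiableOn ℂ F U)
    (hray : ∀ z ∈ U, ∀ t : ℝ, 0 < t → F (t * z) = F z) {z w : ℂ} (hz : z ∈ U) (hw : w ∈ U) :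
    F z = F w := by
  refine hU.is_const_of_deriv_eq_zero hconv.isPreconnected hF (fun z hz => ?_) hz hw
  have hF' : HasDerivAt F (deriv F z) (((1 : ℝ) : ℂ) * z) := by
    simpa only [Complex.ofReal_one, one_mul] using
      (hF.differentiableAt (hU.mem_nhds hz)).hasDerivAt
  have hline : HasDerivAt (fun t : ℝ => (t : ℂ) * z) z 1 := by
    simpa using (Complex.ofRealCLM.hasDerivAt (x := (1 : ℝ))).mul_const z
  have hconst : HasDerivAt (fun t : ℝ => F ((t : ℂ) * z)) 0 1 := by
    refine (hasDerivAt_const (1 : ℝ) (F z)).congr_of_eventuallyEq ?_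
    filter_upwards [lt_mem_nhds zero_lt_one] with t ht using hray z hz t ht
  have hz0 : z ≠ 0 := fun h => h0 (h ▸ hz)
  exact (smul_eq_zero_iff_right hz0).1 ((hF'.scomp (1 : ℝ) hline).unique hconst)

end ParametricIntegral

section PosOrthant

variable {E : Type*} [NormedAddCommGroup E]

theorem integral_Ioi_of_hasDerivAt_of_tendsto_zero [NormedSpace ℝ E] [CompleteSpace E]
    {g g' : ℝ → E} {c : ℝ} (hderiv : ∀ t ∈ Set.Ioi c, HasDerivAt g (g' t) t)
    (hg : IntegrableOn g (Set.Ioi c)) (hg' : IntegrableOn g' (Set.Ioi c))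
    (hzero : Tendsto g (𝓝[>] c) (𝓝 0)) : ∫ t in Set.Ioi c, g' t = 0 := by
  have heq : ∀ t ∈ Set.Ioi c, Function.update g c 0 =ᶠ[𝓝 t] g := fun t ht =>
    (eventually_ne_nhds (ne_of_gt ht)).mono fun s hs => Function.update_of_ne hs _ _
  have hcont : ContinuousWithinAt (Function.update g c 0) (Set.Ici c) c := by
    rwa [continuousWithinAt_update_same, Set.Ici_sdiff_left]
  have hinf : Tendsto (Function.update g c 0) atTop (𝓝 0) :=
    (tendsto_zero_of_hasDerivAt_of_integrableOn_Ioi hderiv hg' hg).congr' <|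
      (eventually_gt_atTop c).mono fun t ht => (heq t ht).eq_of_nhds.symm
  simpa using integral_Ioi_of_hasDerivAt_of_tendsto hcont
    (fun t ht => (hderiv t ht).congr_of_eventuallyEq (heq t ht)) hg' hinf

/-- The open positive orthant of `ℝ^k`, over which all integrals are taken after passing to
linear coordinates on the cone `C_X^+`. -/
def posOrthant (k : ℕ) : Set (Fin k → ℝ) := {a | ∀ m, 0 < a m}

theorem posOrthant_eq_pi (k : ℕ) : posOrthant k = Set.univ.pi fun _ => Set.Ioi 0 := by
  ext; simp [posOrthant]

theorem measurableSet_posOrthant (k : ℕ) : MeasurableSet (posOrthant k) := by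
  rw [posOrthant_eq_pi]
  exact MeasurableSet.univ_pi fun _ => measurableSet_Ioi

theorem volume_restrict_posOrthant (k : ℕ) :
    (volume : Measure (Fin k → ℝ)).restrict (posOrthant k) =
      Measure.pi fun _ => volume.restrict (Set.Ioi 0) := by
  rw [posOrthant_eq_pi, volume_pi, Measure.restrict_pi_pi]

theorem smul_posOrthant {k : ℕ} {t : ℝ} (ht : 0 < t) : t • posOrthant k = posOrthant k := by
  ext x
  simp [Set.mem_smul_set_iff_inv_smul_mem₀ ht.ne', posOrthant, ht]

theorem insertNth_mem_posOrthant {n : ℕ} (m : Fin (n + 1)) (t : ℝ) (y : Fin n → ℝ) :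
    m.insertNth (α := fun _ => ℝ) t y ∈ posOrthant (n + 1) ↔ 0 < t ∧ y ∈ posOrthant n := by
  simp [posOrthant, Fin.forall_iff_succAbove m]

theorem measurePreserving_insertNth_posOrthant {n : ℕ} (m : Fin (n + 1)) :
    MeasurePreserving (MeasurableEquiv.piFinSuccAbove (fun _ : Fin (n + 1) => ℝ) m).symm
      ((volume.restrict (Set.Ioi (0 : ℝ))).prod
        ((volume : Measure (Fin n → ℝ)).restrict (posOrthant n)))
      (volume.restrict (posOrthant (n + 1))) := by
  have hpre : (MeasurableEquiv.piFinSuccAbove (fun _ : Fin (n + 1) => ℝ) m).symm ⁻¹'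
      posOrthant (n + 1) = Set.Ioi 0 ×ˢ posOrthant n :=
    Set.ext fun p => insertNth_mem_posOrthant m p.1 p.2
  rw [Measure.prod_restrict, ← hpre]
  exact ((volume_preserving_piFinSuccAbove (fun _ : Fin (n + 1) => ℝ) m).symm _).restrict_preimage
    (measurableSet_posOrthant (n + 1))

theorem setIntegral_posOrthant_eq_zero_of_hasDerivAt_update [NormedSpace ℝ E] [CompleteSpace E]
    {k : ℕ} (m : Fin k) {G G' : (Fin k → ℝ) → E} (hG : IntegrableOn G (posOrthant k))
    (hG' : IntegrableOn G' (posOrthant k))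
    (hderiv : ∀ a ∈ posOrthant k, HasDerivAt (fun t => G (Function.update a m t)) (G' a) (a m))
    (hzero : ∀ a ∈ posOrthant k, Tendsto (fun t => G (Function.update a m t)) (𝓝[>] 0) (𝓝 0)) :
    ∫ a in posOrthant k, G' a = 0 := by
  obtain ⟨n, rfl⟩ : ∃ n, k = n + 1 := ⟨k - 1, by have := m.2; omega⟩
  let e := (MeasurableEquiv.piFinSuccAbove (fun _ : Fin (n + 1) => ℝ) m).symm
  have he := measurePreserving_insertNth_posOrthant m
  have hfiber : ∀ {H : (Fin (n + 1) → ℝ) → E}, IntegrableOn H (posOrthant (n + 1)) →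
      Integrable (fun p => H (e p)) ((volume.restrict (Set.Ioi (0 : ℝ))).prod
        ((volume : Measure (Fin n → ℝ)).restrict (posOrthant n))) := fun hH =>
    (he.integrable_comp_emb e.measurableEmbedding).2 hH
  have hupdate : ∀ (s t : ℝ) (y : Fin n → ℝ), Function.update (e (s, y)) m t = e (t, y) :=
    fun s t y => Fin.update_insertNth (α := fun _ => ℝ) m s t y
  have happly : ∀ (t : ℝ) (y : Fin n → ℝ), e (t, y) m = t :=
    fun t y => Fin.insertNth_apply_same (α := fun _ => ℝ) m t y
  rw [← he.integral_comp e.measurableEmbedding, integral_prod_symm _ (hfiber hG')]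
  refine integral_eq_zero_of_ae ?_
  filter_upwards [(hfiber hG).prod_left_ae, (hfiber hG').prod_left_ae,
    ae_restrict_mem (measurableSet_posOrthant n)] with y hGy hGy' hy
  have hmem : ∀ t : ℝ, 0 < t → e (t, y) ∈ posOrthant (n + 1) := fun t ht =>
    (insertNth_mem_posOrthant m t y).2 ⟨ht, hy⟩
  refine integral_Ioi_of_hasDerivAt_of_tendsto_zero (g := fun t => G (e (t, y)))
    (fun t ht => ?_) hGy hGy' ?_
  · simpa only [hupdate, happly] using hderiv _ (hmem t ht)
  · simpa only [hupdate] using hzero _ (hmem 1 one_pos)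

end PosOrthant

section GammaDensity

theorem integrableOn_rpow_mul_cexp_neg_mul_Ioi {γ : ℝ} (hγ : -1 < γ) {μ : ℂ} (hμ : 0 < μ.re) :
    IntegrableOn (fun t : ℝ => ((t ^ γ : ℝ) : ℂ) * Complex.exp (-μ * t)) (Set.Ioi 0) := by
  have hreal : IntegrableOn (fun t : ℝ => t ^ γ * Real.exp (-μ.re * t)) (Set.Ioi 0) := by
    simpa only [Real.rpow_one] using integrableOn_rpow_mul_exp_neg_mul_rpow hγ one_pos hμ
  refine hreal.mono' (by fun_prop) ?_
  filter_upwards [ae_restrict_mem measurableSet_Ioi] with t ht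
  rw [norm_mul, Complex.norm_real, Complex.norm_exp, Complex.re_mul_ofReal, Complex.neg_re,
    Real.norm_of_nonneg (Real.rpow_nonneg (le_of_lt ht) _)]

theorem differentiableOn_integral_rpow_mul_cexp_neg_mul_Ioi {γ : ℝ} (hγ : -1 < γ) :
    DifferentiableOn ℂ
      (fun μ : ℂ => ∫ t : ℝ in Set.Ioi 0, ((t ^ γ : ℝ) : ℂ) * Complex.exp (-μ * t))
      {μ | 0 < μ.re} := by
  intro μ hμ
  have hre : ∀ z ∈ Metric.ball μ (μ.re / 2), μ.re / 2 ≤ z.re := fun z hz => by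
    have := (Complex.abs_re_le_norm (z - μ)).trans_lt (mem_ball_iff_norm.1 hz)
    rw [Complex.sub_re, abs_lt] at this
    linarith
  refine (hasDerivAt_integral_of_dominated_of_differentiableOn (half_pos hμ)
    (bound := fun t : ℝ => ‖((t ^ γ : ℝ) : ℂ) * Complex.exp (-((μ.re / 2 : ℝ) : ℂ) * t)‖)
    (fun z _ => by fun_prop) (ae_of_all _ fun t => by fun_prop) ?_
    (integrableOn_rpow_mul_cexp_neg_mul_Ioi hγ (half_pos hμ)).norm
    ).differentiableAt.differentiableWithinAt
  filter_upwards [ae_restrict_mem measurableSet_Ioi] with t ht z hz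
  simp only [norm_mul, Complex.norm_exp, Complex.re_mul_ofReal, Complex.neg_re,
    Complex.ofReal_re]
  gcongr
  exacts [le_of_lt ht, hre z hz]

theorem integral_rpow_mul_cexp_neg_ofReal_mul_Ioi {γ : ℝ} (hγ : -1 < γ) {r : ℝ} (hr : 0 < r) :
    ∫ t : ℝ in Set.Ioi 0, ((t ^ γ : ℝ) : ℂ) * Complex.exp (-(r : ℂ) * t) =
      Real.Gamma (γ + 1) * (r : ℂ) ^ (-(γ + 1 : ℝ) : ℂ) := by
  have hGamma := Real.integral_rpow_mul_exp_neg_mul_Ioi (a := γ + 1) (by linarith) hr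
  rw [add_sub_cancel_right, one_div, Real.inv_rpow hr.le, ← Real.rpow_neg hr.le, mul_comm] at hGamma
  rw [← Complex.ofReal_neg (γ + 1), ← Complex.ofReal_cpow hr.le, ← Complex.ofReal_mul, ← hGamma,
    ← integral_complex_ofReal]
  simp only [Complex.ofReal_mul, Complex.ofReal_exp, neg_mul, Complex.ofReal_neg]

theorem integral_rpow_mul_cexp_neg_mul_Ioi {γ : ℝ} (hγ : -1 < γ) {μ : ℂ} (hμ : 0 < μ.re) :
    ∫ t : ℝ in Set.Ioi 0, ((t ^ γ : ℝ) : ℂ) * Complex.exp (-μ * t) =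
      Real.Gamma (γ + 1) * μ ^ (-(γ + 1 : ℝ) : ℂ) := by
  have hopen : IsOpen {μ : ℂ | 0 < μ.re} := isOpen_lt continuous_const Complex.continuous_re
  have hpow : DifferentiableOn ℂ (fun μ : ℂ => (Real.Gamma (γ + 1) : ℂ) * μ ^ (-(γ + 1 : ℝ) : ℂ))
      {μ | 0 < μ.re} := fun z hz =>
    (DifferentiableAt.const_mul (differentiableAt_id.cpow_const (Or.inl hz))
      _).differentiableWithinAt
  refine ((differentiableOn_integral_rpow_mul_cexp_neg_mul_Ioi hγ).analyticOnNhd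
    hopen).eqOn_of_preconnected_of_frequently_eq (hpow.analyticOnNhd hopen)
    (convex_halfSpace_re_gt 0).isPreconnected (z₀ := 1) (by simp) ?_ hμ
  have hpositive : Tendsto (fun n : ℕ => ((1 + 1 / ((n : ℝ) + 1) : ℝ) : ℂ)) atTop (𝓝[≠] 1) := by
    refine tendsto_nhdsWithin_iff.2 ⟨?_, Eventually.of_forall fun n => ?_⟩
    · simpa using (tendsto_one_div_add_atTop_nhds_zero_nat (𝕜 := ℝ)).const_add 1 |>.ofReal
    · rw [Set.mem_compl_singleton_iff, Ne, Complex.ofReal_eq_one, add_eq_left]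
      positivity
  refine hpositive.frequently (Eventually.of_forall fun n => ?_).frequently
  have hr : 0 < 1 + 1 / ((n : ℝ) + 1) := by positivity
  exact integral_rpow_mul_cexp_neg_ofReal_mul_Ioi hγ hr

variable {k : ℕ} {γ : Fin k → ℝ}

/-- The function `∏_m a_m ^ γ_m e^{-μ a_m}`, the leading factor of the integrands below; its
integral over the orthant is a product of Gamma integrals. -/
def gammaDensity (γ : Fin k → ℝ) (μ : ℂ) (a : Fin k → ℝ) : ℂ :=
  ∏ m, ((a m ^ γ m : ℝ) : ℂ) * Complex.exp (-μ * a m)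

theorem integrableOn_gammaDensity (hγ : ∀ m, -1 < γ m) {μ : ℂ} (hμ : 0 < μ.re) :
    IntegrableOn (gammaDensity γ μ) (posOrthant k) := by
  rw [IntegrableOn, volume_restrict_posOrthant]
  exact Integrable.fintype_prod_dep fun m => integrableOn_rpow_mul_cexp_neg_mul_Ioi (hγ m) hμ

theorem integral_gammaDensity (hγ : ∀ m, -1 < γ m) {μ : ℂ} (hμ : 0 < μ.re) :
    ∫ a in posOrthant k, gammaDensity γ μ a =
      ∏ m, (Real.Gamma (γ m + 1) : ℂ) * μ ^ (-(γ m + 1 : ℝ) : ℂ) := by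
  rw [volume_restrict_posOrthant]
  exact (integral_fintype_prod_eq_prod fun m (t : ℝ) =>
    ((t ^ γ m : ℝ) : ℂ) * Complex.exp (-μ * t)).trans
      (Finset.prod_congr rfl fun m _ => integral_rpow_mul_cexp_neg_mul_Ioi (hγ m) hμ)

theorem norm_gammaDensity_le {s : ℝ} {μ : ℂ} (hs : s ≤ μ.re) {a : Fin k → ℝ}
    (ha : a ∈ posOrthant k) : ‖gammaDensity γ μ a‖ ≤ ‖gammaDensity γ s a‖ := by
  simp only [gammaDensity, norm_prod, norm_mul, Complex.norm_exp, Complex.re_mul_ofReal,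
    Complex.neg_re, Complex.ofReal_re]
  gcongr with m
  exact (ha m).le

theorem norm_gammaDensity_mul_exp (s η : ℝ) (a : Fin k → ℝ) :
    ‖gammaDensity γ s a‖ * Real.exp (η * ∑ m, a m) =
      ‖gammaDensity γ ((s - η : ℝ) : ℂ) a‖ := by
  simp only [gammaDensity, norm_prod, norm_mul, Complex.norm_exp, Complex.re_mul_ofReal,
    Complex.neg_re, Complex.ofReal_re, Finset.mul_sum, Real.exp_sum, ← Finset.prod_mul_distrib]
  refine Finset.prod_congr rfl fun m _ => ?_
  rw [mul_assoc, ← Real.exp_add]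
  ring_nf

theorem continuousOn_gammaDensity (μ : ℂ) : ContinuousOn (gammaDensity γ μ) (posOrthant k) :=
  continuousOn_finsetProd _ fun m _ => ContinuousOn.mul
    (Complex.continuous_ofReal.comp_continuousOn
      ((continuous_apply m).continuousOn.rpow_const fun _ ha => Or.inl (ha m).ne'))
    (by fun_prop)

theorem differentiable_gammaDensity (a : Fin k → ℝ) :
    Differentiable ℂ fun μ => gammaDensity γ μ a := by
  unfold gammaDensity
  fun_prop

end GammaDensity

section OuterForm

variable {ι : Type*} {k : ℕ} {q : ι → ℝ} {b : ι → Fin k → ℝ} {S : Finset ι} {β : ι → ℝ}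
  {γ : Fin k → ℝ} {ρ : ℂ} {δ : ℝ}

/-- The affine form `q_i + ρ ∑_m b_{i,m} a_m`: the values on the cone turned by `ρ` of an affine
form that does not vanish at its apex. -/
def outerForm (q : ι → ℝ) (b : ι → Fin k → ℝ) (ρ : ℂ) (a : Fin k → ℝ) (i : ι) : ℂ :=
  (q i : ℂ) + ρ * ((∑ m, b i m * a m : ℝ) : ℂ)

/-- The double sector of directions `ρ` whose angle with the real axis has sine at least `δ`. -/
def imSector (δ : ℝ) : Set ℂ := {ρ | ρ.im ≠ 0 ∧ δ * ‖ρ‖ ≤ |ρ.im|}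

theorem norm_pos_of_im_ne_zero (hρ : ρ.im ≠ 0) : 0 < ‖ρ‖ :=
  norm_pos_iff.2 fun h => hρ (by rw [h, Complex.zero_im])

theorem exists_pos_mem_imSector (hρ : ρ.im ≠ 0) : ∃ δ, 0 < δ ∧ ρ ∈ imSector δ :=
  ⟨|ρ.im| / ‖ρ‖, div_pos (abs_pos.2 hρ) (norm_pos_of_im_ne_zero hρ), hρ,
    (div_mul_cancel₀ _ (norm_pos_of_im_ne_zero hρ).ne').le⟩

theorem eventually_mem_imSector (hδ : δ * ‖ρ‖ < |ρ.im|) (hρ : ρ.im ≠ 0) :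
    ∀ᶠ z in 𝓝 ρ, z ∈ imSector δ :=
  (Complex.continuous_im.continuousAt.eventually_ne hρ).and <|
    ((continuous_const.mul continuous_norm).continuousAt.eventually_lt
      Complex.continuous_im.abs.continuousAt hδ).mono fun _ => le_of_lt

theorem outerForm_mem_slitPlane {i : ι} (hq : 0 < q i) (hρ : ρ.im ≠ 0) (a : Fin k → ℝ) :
    outerForm q b ρ a i ∈ Complex.slitPlane := by
  rw [Complex.mem_slitPlane_iff, outerForm, Complex.add_im, Complex.ofReal_im, zero_add,
    Complex.im_mul_ofReal, mul_ne_zero_iff]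
  by_cases h : ∑ m, b i m * a m = 0
  · left
    simpa [h] using hq
  · exact Or.inr ⟨hρ, h⟩

theorem le_norm_outerForm {i : ι} (hq : 0 ≤ q i) (hρ : ρ ∈ imSector δ) (a : Fin k → ℝ) :
    q i * δ ≤ ‖outerForm q b ρ a i‖ := by
  have him : (outerForm q b ρ a i * (starRingEnd ℂ) ρ).im = -(q i * ρ.im) := by
    simp [outerForm]
    ring
  refine le_of_mul_le_mul_right ?_ (norm_pos_of_im_ne_zero hρ.1)
  calc q i * δ * ‖ρ‖ = q i * (δ * ‖ρ‖) := mul_assoc _ _ _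
    _ ≤ q i * |ρ.im| := mul_le_mul_of_nonneg_left hρ.2 hq
    _ = |(outerForm q b ρ a i * (starRingEnd ℂ) ρ).im| := by
      rw [him, abs_neg, abs_mul, abs_of_nonneg hq]
    _ ≤ ‖outerForm q b ρ a i * (starRingEnd ℂ) ρ‖ := Complex.abs_im_le_norm _
    _ = ‖outerForm q b ρ a i‖ * ‖ρ‖ := by rw [norm_mul, RCLike.norm_conj]

theorem norm_outerForm_le {i : ι} {R : ℝ} (hq : 0 ≤ q i) (hR : ‖ρ‖ ≤ R) {a : Fin k → ℝ}
    (ha : ∀ m, 0 ≤ a m) :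
    ‖outerForm q b ρ a i‖ ≤ q i + R * (∑ m, |b i m|) * ∑ m, a m := by
  have hsum : |∑ m, b i m * a m| ≤ (∑ m, |b i m|) * ∑ m, a m := by
    refine (Finset.abs_sum_le_sum_abs _ _).trans ?_
    rw [Finset.sum_mul]
    gcongr with m
    rw [abs_mul, abs_of_nonneg (ha m)]
    gcongr
    exact Finset.single_le_sum (fun m _ => ha m) (Finset.mem_univ m)
  have hR0 : 0 ≤ R := (norm_nonneg _).trans hR
  refine (norm_add_le _ _).trans ?_
  rw [norm_mul, Complex.norm_real, Complex.norm_real, Real.norm_of_nonneg hq, Real.norm_eq_abs,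
    mul_assoc]
  gcongr

theorem exists_rpow_le_mul_exp {κ A B η : ℝ} (hκ : 0 < κ) (hA : 0 < A) (hB : 0 ≤ B) (hη : 0 < η)
    (p : ℝ) :
    ∃ C, 0 < C ∧ ∀ s x : ℝ, 0 ≤ s → κ ≤ x → x ≤ A + B * s → x ^ p ≤ C * Real.exp (η * s) := by
  rcases le_or_gt p 0 with hp | hp
  · refine ⟨κ ^ p, by positivity, fun s x hs hx _ => ?_⟩
    calc x ^ p ≤ κ ^ p := Real.rpow_le_rpow_of_nonpos hκ hx hp
      _ ≤ κ ^ p * Real.exp (η * s) :=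
        le_mul_of_one_le_right (by positivity) (Real.one_le_exp (by positivity))
  · have hθ : 0 < η / p := by positivity
    refine ⟨(A + B / (η / p)) ^ p, by positivity, fun s x hs hx hxs => ?_⟩
    have hlin : x ≤ (A + B / (η / p)) * Real.exp (η / p * s) := by
      have hexp := Real.add_one_le_exp (η / p * s)
      calc x ≤ A * 1 + B / (η / p) * (η / p * s) := by
            rw [div_mul_eq_mul_div, ← mul_assoc, mul_comm B, mul_assoc,
              mul_div_cancel_left₀ _ hθ.ne']
            linarith
        _ ≤ A * Real.exp (η / p * s) + B / (η / p) * Real.exp (η / p * s) := by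
            gcongr
            exacts [Real.one_le_exp (by positivity), by linarith]
        _ = _ := (add_mul _ _ _).symm
    calc x ^ p ≤ ((A + B / (η / p)) * Real.exp (η / p * s)) ^ p := by gcongr; linarith
      _ = (A + B / (η / p)) ^ p * Real.exp (η * s) := by
        rw [Real.mul_rpow (by positivity) (Real.exp_pos _).le, ← Real.exp_mul]
        congr 2
        field_simp

theorem exists_norm_prod_outerForm_cpow_le (hq : ∀ i ∈ S, 0 < q i) (hδ : 0 < δ) {R : ℝ}
    (hR : 0 ≤ R) (β : ι → ℝ) {η : ℝ} (hη : 0 < η) :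
    ∃ C, 0 ≤ C ∧ ∀ ρ ∈ imSector δ, ‖ρ‖ ≤ R → ∀ a ∈ posOrthant k,
      ‖∏ i ∈ S, outerForm q b ρ a i ^ (β i : ℂ)‖ ≤ C * Real.exp (η * ∑ m, a m) := by
  classical
  induction S using Finset.induction_on generalizing η with
  | empty =>
    refine ⟨1, zero_le_one, fun ρ _ _ a ha => ?_⟩
    have : 0 ≤ ∑ m, a m := Finset.sum_nonneg fun m _ => (ha m).le
    rw [Finset.prod_empty, norm_one, one_mul]
    exact Real.one_le_exp (by positivity)
  | insert i S hi ih =>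
    rw [Finset.forall_mem_insert] at hq
    obtain ⟨C, hC, hprod⟩ := ih hq.2 (half_pos hη)
    obtain ⟨C', hC', hfactor⟩ := exists_rpow_le_mul_exp (mul_pos hq.1 hδ) hq.1
      (mul_nonneg hR (Finset.sum_nonneg fun m _ => abs_nonneg (b i m))) (half_pos hη) (β i)
    refine ⟨C' * C, by positivity, fun ρ hρ hρR a ha => ?_⟩
    rw [Finset.prod_insert hi, norm_mul, Complex.norm_cpow_real]
    calc _ ≤ (C' * Real.exp (η / 2 * ∑ m, a m)) * (C * Real.exp (η / 2 * ∑ m, a m)) :=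
          mul_le_mul (hfactor _ _ (Finset.sum_nonneg fun m _ => (ha m).le)
            (le_norm_outerForm hq.1.le hρ a) (norm_outerForm_le hq.1.le hρR fun m => (ha m).le))
            (hprod ρ hρ hρR a ha) (norm_nonneg _) (by positivity)
      _ = C' * C * Real.exp (η * ∑ m, a m) := by
          rw [mul_mul_mul_comm, ← Real.exp_add]
          ring_nf

theorem continuousOn_prod_outerForm_cpow (hq : ∀ i ∈ S, 0 < q i) (hρ : ρ.im ≠ 0)
    (s : Set (Fin k → ℝ)) :
    ContinuousOn (fun a => ∏ i ∈ S, outerForm q b ρ a i ^ (β i : ℂ)) s :=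
  continuousOn_finsetProd _ fun i hi => ContinuousOn.cpow_const
    (by unfold outerForm; fun_prop) fun a _ => outerForm_mem_slitPlane (hq i hi) hρ a

theorem tendsto_prod_outerForm_cpow {τ : Type*} {f : Filter τ} {v : τ → ℂ}
    (hq : ∀ i ∈ S, 0 < q i) (hv : Tendsto v f (𝓝 0)) (a : Fin k → ℝ) :
    Tendsto (fun t => ∏ i ∈ S, outerForm q b (v t) a i ^ (β i : ℂ)) f
      (𝓝 ((∏ i ∈ S, q i ^ β i : ℝ) : ℂ)) := by
  rw [Complex.ofReal_prod]
  refine tendsto_finsetProd _ fun i hi => ?_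
  rw [Complex.ofReal_cpow (hq i hi).le]
  refine Tendsto.cpow ?_ tendsto_const_nhds (Complex.ofReal_mem_slitPlane.2 (hq i hi))
  simpa only [outerForm, zero_mul, add_zero] using
    (hv.mul_const ((∑ m, b i m * a m : ℝ) : ℂ)).const_add (q i : ℂ)

end OuterForm

section LaplaceCore

variable {ι : Type*} {k : ℕ} {q : ι → ℝ} {b : ι → Fin k → ℝ} {S : Finset ι} {β : ι → ℝ}
  {γ : Fin k → ℝ} {μ ρ : ℂ} {δ s : ℝ}

/-- The integrand of a Laplace integral over the orthant: `gammaDensity` carries the singularities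
at the apex of the cone, the other affine forms enter by powers. -/
def laplaceCore (S : Finset ι) (q : ι → ℝ) (b : ι → Fin k → ℝ) (γ : Fin k → ℝ) (β : ι → ℝ)
    (μ ρ : ℂ) (a : Fin k → ℝ) : ℂ :=
  gammaDensity γ μ a * ∏ i ∈ S, outerForm q b ρ a i ^ (β i : ℂ)

theorem exists_norm_laplaceCore_le (hq : ∀ i ∈ S, 0 < q i) (hs : 0 < s) (hδ : 0 < δ) {R : ℝ}
    (hR : 0 ≤ R) (γ : Fin k → ℝ) (β : ι → ℝ) :
    ∃ C, ∀ μ : ℂ, s ≤ μ.re → ∀ ρ ∈ imSector δ, ‖ρ‖ ≤ R → ∀ a ∈ posOrthant k,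
      ‖laplaceCore S q b γ β μ ρ a‖ ≤ C * ‖gammaDensity γ ((s / 2 : ℝ) : ℂ) a‖ := by
  obtain ⟨C, -, hprod⟩ := exists_norm_prod_outerForm_cpow_le (b := b) hq hδ hR β (half_pos hs)
  refine ⟨C, fun μ hμ ρ hρ hρR a ha => ?_⟩
  calc ‖laplaceCore S q b γ β μ ρ a‖
      ≤ ‖gammaDensity γ s a‖ * (C * Real.exp (s / 2 * ∑ m, a m)) := by
        rw [laplaceCore, norm_mul]
        gcongr
        exacts [norm_gammaDensity_le hμ ha, hprod ρ hρ hρR a ha]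
    _ = C * ‖gammaDensity γ ((s / 2 : ℝ) : ℂ) a‖ := by
        rw [mul_left_comm, norm_gammaDensity_mul_exp, sub_half]

theorem aestronglyMeasurable_laplaceCore (hq : ∀ i ∈ S, 0 < q i) (hρ : ρ.im ≠ 0) :
    AEStronglyMeasurable (laplaceCore S q b γ β μ ρ) (volume.restrict (posOrthant k)) :=
  ((continuousOn_gammaDensity μ).mul
    (continuousOn_prod_outerForm_cpow hq hρ _)).aestronglyMeasurable (measurableSet_posOrthant k)

theorem integrableOn_laplaceCore (hq : ∀ i ∈ S, 0 < q i) (hγ : ∀ m, -1 < γ m) (hμ : 0 < μ.re)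
    (hρ : ρ.im ≠ 0) : IntegrableOn (laplaceCore S q b γ β μ ρ) (posOrthant k) := by
  obtain ⟨δ, hδ, hρδ⟩ := exists_pos_mem_imSector hρ
  obtain ⟨C, hC⟩ := exists_norm_laplaceCore_le (b := b) hq hμ hδ (norm_nonneg ρ) γ β
  have hdom := integrableOn_gammaDensity (μ := ((μ.re / 2 : ℝ) : ℂ)) hγ (half_pos hμ)
  refine (hdom.norm.const_mul C).mono' (aestronglyMeasurable_laplaceCore hq hρ) ?_
  filter_upwards [ae_restrict_mem (measurableSet_posOrthant k)] with a ha
  exact hC μ le_rfl ρ hρδ le_rfl a ha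

theorem differentiableAt_laplaceCore (hq : ∀ i ∈ S, 0 < q i) {u v : ℂ → ℂ} {z : ℂ}
    (hu : DifferentiableAt ℂ u z) (hv : DifferentiableAt ℂ v z) (hz : (v z).im ≠ 0)
    (a : Fin k → ℝ) : DifferentiableAt ℂ (fun z => laplaceCore S q b γ β (u z) (v z) a) z := by
  refine ((differentiable_gammaDensity a).differentiableAt.comp z hu).mul
    (DifferentiableAt.fun_finsetProd fun i hi => ?_)
  exact DifferentiableAt.cpow_const (f := fun z => outerForm q b (v z) a i)
    (by unfold outerForm; fun_prop) (outerForm_mem_slitPlane (hq i hi) hz a)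

theorem hasDerivAt_integral_laplaceCore (hq : ∀ i ∈ S, 0 < q i) (hγ : ∀ m, -1 < γ m)
    {u v : ℂ → ℂ} (hu : Differentiable ℂ u) (hv : Differentiable ℂ v) {z₀ : ℂ}
    (hu₀ : 0 < (u z₀).re) (hv₀ : (v z₀).im ≠ 0) :
    HasDerivAt (fun z => ∫ a in posOrthant k, laplaceCore S q b γ β (u z) (v z) a)
      (∫ a in posOrthant k, deriv (fun z => laplaceCore S q b γ β (u z) (v z) a) z₀) z₀ := by
  obtain ⟨δ, hδ, -, hδv⟩ := exists_pos_mem_imSector hv₀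
  have hsector : δ / 2 * ‖v z₀‖ < |(v z₀).im| := by
    have := mul_pos hδ (norm_pos_of_im_ne_zero hv₀)
    linarith
  have hnear : ∀ᶠ z in 𝓝 z₀,
      (u z₀).re / 2 < (u z).re ∧ ‖v z‖ < ‖v z₀‖ + 1 ∧ v z ∈ imSector (δ / 2) :=
    ((Complex.continuous_re.comp hu.continuous).continuousAt.eventually_const_lt
      (half_lt_self hu₀)).and <|
    (hv.continuous.norm.continuousAt.eventually_lt_const (lt_add_one _)).and <|
    hv.continuous.continuousAt.eventually (eventually_mem_imSector hsector hv₀)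
  obtain ⟨r, hr, hball⟩ := Metric.eventually_nhds_iff_ball.1 hnear
  obtain ⟨C, hC⟩ := exists_norm_laplaceCore_le (b := b) hq (half_pos hu₀) (half_pos hδ)
    (by positivity : 0 ≤ ‖v z₀‖ + 1) γ β
  refine hasDerivAt_integral_of_dominated_of_differentiableOn hr
    (fun z hz => aestronglyMeasurable_laplaceCore hq (hball z hz).2.2.1)
    (ae_of_all _ fun a z hz => (differentiableAt_laplaceCore hq hu.differentiableAt
      hv.differentiableAt (hball z hz).2.2.1 a).differentiableWithinAt) ?_
    ((integrableOn_gammaDensity (μ := (((u z₀).re / 2 / 2 : ℝ) : ℂ)) hγ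
      (half_pos (half_pos hu₀))).norm.const_mul C)
  filter_upwards [ae_restrict_mem (measurableSet_posOrthant k)] with a ha z hz
  exact hC _ (hball z hz).1.le _ (hball z hz).2.2 (hball z hz).2.1.le a ha

theorem tendsto_integral_gammaDensity_mul {τ : Type*} {f : Filter τ} [f.IsCountablyGenerated]
    (hγ : ∀ m, -1 < γ m) {u : τ → ℂ} (hs : 0 < s) (hu : ∀ᶠ t in f, s ≤ (u t).re)
    {g : τ → (Fin k → ℝ) → ℂ} {C : ℝ}
    (hmeas : ∀ᶠ t in f, AEStronglyMeasurable (g t) (volume.restrict (posOrthant k)))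
    (hbound : ∀ᶠ t in f, ∀ a ∈ posOrthant k, ‖g t a‖ ≤ C * Real.exp (s / 2 * ∑ m, a m))
    (hzero : ∀ a ∈ posOrthant k, Tendsto (fun t => g t a) f (𝓝 0)) :
    Tendsto (fun t => ∫ a in posOrthant k, gammaDensity γ (u t) a * g t a) f (𝓝 0) := by
  rw [← integral_zero (Fin k → ℝ) ℂ (μ := volume.restrict (posOrthant k))]
  refine tendsto_integral_filter_of_dominated_convergence
    (fun a => C * ‖gammaDensity γ ((s / 2 : ℝ) : ℂ) a‖) ?_ ?_
    ((integrableOn_gammaDensity (μ := ((s / 2 : ℝ) : ℂ)) hγ (half_pos hs)).norm.const_mul C) ?_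
  · filter_upwards [hmeas] with t ht
    exact ((continuousOn_gammaDensity _).aestronglyMeasurable (measurableSet_posOrthant k)).mul ht
  · filter_upwards [hu, hbound] with t hut hgt
    filter_upwards [ae_restrict_mem (measurableSet_posOrthant k)] with a ha
    calc ‖gammaDensity γ (u t) a * g t a‖
        ≤ ‖gammaDensity γ s a‖ * (C * Real.exp (s / 2 * ∑ m, a m)) := by
          rw [norm_mul]
          exact mul_le_mul (norm_gammaDensity_le hut ha) (hgt a ha) (norm_nonneg _) (norm_nonneg _)
      _ = C * ‖gammaDensity γ ((s / 2 : ℝ) : ℂ) a‖ := by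
          rw [mul_left_comm, norm_gammaDensity_mul_exp, sub_half]
  · filter_upwards [ae_restrict_mem (measurableSet_posOrthant k)] with a ha
    refine squeeze_zero_norm' (a := fun t => ‖gammaDensity γ s a‖ * ‖g t a‖) ?_ ?_
    · filter_upwards [hu] with t hut
      rw [norm_mul]
      exact mul_le_mul_of_nonneg_right (norm_gammaDensity_le hut ha) (norm_nonneg _)
    · simpa using (hzero a ha).norm.const_mul ‖gammaDensity γ s a‖

theorem tendsto_integral_laplaceCore_sub {τ : Type*} {f : Filter τ} [f.IsCountablyGenerated]
    (hq : ∀ i ∈ S, 0 < q i) (hγ : ∀ m, -1 < γ m) {u v : τ → ℂ} (hs : 0 < s) (hδ : 0 < δ)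
    (hu : ∀ᶠ t in f, s ≤ (u t).re) (hvδ : ∀ᶠ t in f, v t ∈ imSector δ)
    (hv : Tendsto v f (𝓝 0)) :
    Tendsto (fun t => (∫ a in posOrthant k, laplaceCore S q b γ β (u t) (v t) a) -
      ((∏ i ∈ S, q i ^ β i : ℝ) : ℂ) * ∫ a in posOrthant k, gammaDensity γ (u t) a) f (𝓝 0) := by
  set c : ℂ := ((∏ i ∈ S, q i ^ β i : ℝ) : ℂ)
  obtain ⟨C, -, hC⟩ := exists_norm_prod_outerForm_cpow_le (b := b) hq hδ zero_le_one β (half_pos hs)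
  have hv1 : ∀ᶠ t in f, ‖v t‖ < 1 := hv.norm.eventually_lt_const (by simp)
  have hlim : Tendsto (fun t => ∫ a in posOrthant k, gammaDensity γ (u t) a *
      ((∏ i ∈ S, outerForm q b (v t) a i ^ (β i : ℂ)) - c)) f (𝓝 0) := by
    refine tendsto_integral_gammaDensity_mul hγ hs hu (C := C + ‖c‖) ?_ ?_ fun a _ => ?_
    · filter_upwards [hvδ] with t ht
      exact ((continuousOn_prod_outerForm_cpow hq ht.1 _).aestronglyMeasurable
        (measurableSet_posOrthant k)).sub aestronglyMeasurable_const
    · filter_upwards [hvδ, hv1] with t ht ht1 a ha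
      have hsum : 0 ≤ ∑ m, a m := Finset.sum_nonneg fun m _ => (ha m).le
      rw [add_mul]
      exact (norm_sub_le _ _).trans (add_le_add (hC _ ht ht1.le a ha)
        (le_mul_of_one_le_right (norm_nonneg c) (Real.one_le_exp (by positivity))))
    · rw [← sub_self c]
      exact (tendsto_prod_outerForm_cpow hq hv a).sub_const c
  refine hlim.congr' ?_
  filter_upwards [hu, hvδ] with t hut hvt
  have hre : 0 < (u t).re := hs.trans_le hut
  rw [← integral_const_mul, ← integral_sub (integrableOn_laplaceCore hq hγ hre hvt.1)
    ((integrableOn_gammaDensity hγ hre).const_mul c)]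
  refine integral_congr_ae (ae_of_all _ fun a => ?_)
  simp only [laplaceCore]
  ring

end LaplaceCore

theorem abs_real_sign_of_ne_zero {a : ℝ} (ha : a ≠ 0) : |Real.sign a| = 1 := by
  rcases Real.sign_apply_eq_of_ne_zero a ha with h | h <;> simp [h]

theorem real_sign_mul_self (a : ℝ) : Real.sign a * a = |a| := by
  rcases lt_trichotomy a 0 with h | rfl | h
  · rw [Real.sign_of_neg h, neg_one_mul, abs_of_neg h]
  · simp
  · rw [Real.sign_of_pos h, one_mul, abs_of_pos h]

theorem real_sign_mul_abs (a : ℝ) : Real.sign a * |a| = a := by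
  rcases lt_trichotomy a 0 with h | rfl | h
  · rw [Real.sign_of_neg h, abs_of_neg h, neg_one_mul, neg_neg]
  · simp
  · rw [Real.sign_of_pos h, one_mul, abs_of_pos h]

theorem ofReal_mul_cpow {t : ℝ} (ht : 0 < t) {z : ℂ} (hz : z ≠ 0) (s : ℂ) :
    ((t : ℂ) * z) ^ s = (t : ℂ) ^ s * z ^ s := by
  have ht0 : (t : ℂ) ≠ 0 := Complex.ofReal_ne_zero.2 ht.ne'
  rw [Complex.cpow_def_of_ne_zero (mul_ne_zero ht0 hz), Complex.cpow_def_of_ne_zero ht0,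
    Complex.cpow_def_of_ne_zero hz, ← Complex.exp_add, Complex.log_ofReal_mul ht hz,
    Complex.ofReal_log ht.le, add_mul]

namespace GenericArrangement

variable {k N : ℕ} (A : GenericArrangement k N) (X : ArrVertex k N)

section Coordinates

/-- The increasing enumeration `m ↦ j_m` of the elements of a vertex. -/
def idx (m : Fin k) : Fin N := X.1.orderEmbOfFin X.2 m

theorem idx_mem (m : Fin k) : idx X m ∈ X.1 := Finset.orderEmbOfFin_mem _ _ _

theorem idx_injective : Function.Injective (idx X) := (X.1.orderEmbOfFin X.2).injective

theorem exists_idx_eq {j : Fin N} (hj : j ∈ X.1) : ∃ m, idx X m = j :=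
  (Set.ext_iff.1 (Finset.range_orderEmbOfFin X.1 X.2) j).2 hj

@[to_additive]
theorem prod_idx {M : Type*} [CommMonoid M] (g : Fin N → M) :
    ∏ m, g (idx X m) = ∏ j ∈ X.1, g j :=
  Finset.prod_nbij (idx X) (fun m _ => idx_mem X m) (idx_injective X).injOn
    (fun _ hj => (exists_idx_eq X hj).imp fun _ h => ⟨Finset.mem_coe.2 (Finset.mem_univ _), h⟩)
    fun _ _ => rfl

theorem card_erase_idx (m : Fin k) : (X.1.erase (idx X m)).card + 1 = k := by
  rw [Finset.card_erase_add_one (idx_mem X m), X.2]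

theorem idx_mem_erase_iff {m n : Fin k} : idx X n ∈ X.1.erase (idx X m) ↔ n ≠ m := by
  simp [idx_mem, (idx_injective X).eq_iff]

/-- The edge direction `e_{X ∖ {j_m}}` at the vertex `X`. -/
def edge (m : Fin k) : Fin k → ℝ := A.edgeVec (X.1.erase (idx X m))

/-- The slope `l_{j_m}(e_{X ∖ {j_m}})`. -/
def slopeAt (m : Fin k) : ℝ := A.l (idx X m) (A.edge X m)

theorem slopeAt_ne_zero (m : Fin k) : A.slopeAt X m ≠ 0 := A.l_edge_ne X (idx_mem X m)

theorem f0_edge_eq_one (m : Fin k) : A.f0 (A.edge X m) = 1 :=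
  (A.edgeVec_spec _ (card_erase_idx X m)).2

theorem l_idx_edge_of_ne {m n : Fin k} (h : n ≠ m) : A.l (idx X n) (A.edge X m) = 0 :=
  (A.edgeVec_spec _ (card_erase_idx X m)).1 _ ((idx_mem_erase_iff X).2 h)

/-- The linear coordinates `a ↦ ∑_m a_m e_{X ∖ {j_m}}` of the cone of a vertex. -/
def param : (Fin k → ℝ) →ₗ[ℝ] (Fin k → ℝ) := Fintype.linearCombination ℝ (A.edge X)

theorem map_param (g : (Fin k → ℝ) →ₗ[ℝ] ℝ) (a : Fin k → ℝ) :
    g (A.param X a) = ∑ m, g (A.edge X m) * a m := by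
  simp [param, Fintype.linearCombination_apply, mul_comm]

theorem l_idx_param (m : Fin k) (a : Fin k → ℝ) :
    A.l (idx X m) (A.param X a) = A.slopeAt X m * a m := by
  rw [map_param, Finset.sum_eq_single_of_mem m (Finset.mem_univ m) fun n _ hn => by
    rw [l_idx_edge_of_ne A X hn.symm, zero_mul], slopeAt]

theorem f0_param (a : Fin k → ℝ) : A.f0 (A.param X a) = ∑ m, a m := by
  simp [map_param, f0_edge_eq_one]

/-- The coordinates of a vector with respect to the edges at `X`. -/
def coord (v : Fin k → ℝ) (m : Fin k) : ℝ := A.l (idx X m) v / A.slopeAt X m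

theorem param_coord (v : Fin k → ℝ) : A.param X (A.coord X v) = v := by
  refine sub_eq_zero.1 (A.eq_zero_of_l X _ fun j hj => ?_)
  obtain ⟨m, rfl⟩ := exists_idx_eq X hj
  rw [map_sub, l_idx_param, coord, mul_div_cancel₀ _ (A.slopeAt_ne_zero X m), sub_self]

theorem sum_map_edge_mul_coord (g : (Fin k → ℝ) →ₗ[ℝ] ℝ) (v : Fin k → ℝ) :
    ∑ m, g (A.edge X m) * A.coord X v m = g v := by
  rw [← map_param, param_coord]

theorem param_injective : Function.Injective (A.param X) := fun a b h => by
  ext m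
  have := congrArg (A.l (idx X m)) h
  rw [l_idx_param, l_idx_param] at this
  exact mul_left_cancel₀ (A.slopeAt_ne_zero X m) this

theorem cone_eq_image : A.cone X = (fun a => A.point X + A.param X a) '' posOrthant k := by
  ext x
  constructor
  · rintro ⟨a, ha, rfl⟩
    refine ⟨fun m => a (idx X m), fun m => ha _ (idx_mem X m), ?_⟩
    simp only [param, Fintype.linearCombination_apply, edge]
    rw [sum_idx X fun j => a j • A.edgeVec (X.1.erase j)]
  · rintro ⟨a, ha, rfl⟩
    have hinv : ∀ m, (Function.extend (idx X) a 0) (idx X m) = a m :=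
      (idx_injective X).extend_apply _ _
    refine ⟨Function.extend (idx X) a 0, fun j hj => ?_, ?_⟩
    · obtain ⟨m, rfl⟩ := exists_idx_eq X hj
      exact (hinv m).symm ▸ ha m
    · simp only [param, Fintype.linearCombination_apply, edge]
      rw [← sum_idx X fun j => Function.extend (idx X) a 0 j • A.edgeVec (X.1.erase j)]
      simp only [hinv]

/-- The volume distortion of the linear coordinates of the cone. -/
def coneVolume : ℝ := |LinearMap.det (A.param X)|

theorem hasFDerivAt_point_add_param (a : Fin k → ℝ) :
    HasFDerivAt (fun a => A.point X + A.param X a)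
      (LinearMap.toContinuousLinearMap (A.param X)) a :=
  (LinearMap.toContinuousLinearMap (A.param X)).hasFDerivAt.const_add _

theorem injective_point_add_param : Function.Injective fun a => A.point X + A.param X a :=
  (add_right_injective _).comp (A.param_injective X)

theorem setIntegral_cone (g : (Fin k → ℝ) → ℂ) :
    ∫ x in A.cone X, g x =
      (A.coneVolume X : ℂ) * ∫ a in posOrthant k, g (A.point X + A.param X a) := by
  rw [cone_eq_image, integral_image_eq_integral_abs_det_fderiv_smul volume
    (measurableSet_posOrthant k) (fun a _ => (A.hasFDerivAt_point_add_param X a).hasFDerivWithinAt)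
    (A.injective_point_add_param X).injOn, integral_smul, LinearMap.det_toContinuousLinearMap,
    Complex.real_smul]
  rfl

theorem integrableOn_cone {g : (Fin k → ℝ) → ℂ}
    (hg : IntegrableOn (fun a => g (A.point X + A.param X a)) (posOrthant k)) :
    IntegrableOn g (A.cone X) := by
  rw [cone_eq_image, integrableOn_image_iff_integrableOn_abs_det_fderiv_smul volume
    (measurableSet_posOrthant k) (fun a _ => (A.hasFDerivAt_point_add_param X a).hasFDerivWithinAt)
    (A.injective_point_add_param X).injOn]
  exact hg.smul _

end Coordinates

section AbsDet

/-- The matrix of the linear forms `l_{φ(1)}, …, l_{φ(k)}`. -/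
def formMatrix (φ : Fin k → Fin N) : Matrix (Fin k) (Fin k) ℝ :=
  Matrix.of fun a b => A.l (φ a) (Pi.single b 1)

/-- `|det (l_{j_1}, …, l_{j_k})|`, the coefficient of `ω_X`. -/
def absDet : ℝ := |(A.formMatrix (idx X)).det|

theorem formMatrix_mul_toMatrix'_param : A.formMatrix (idx X) * LinearMap.toMatrix' (A.param X) =
    Matrix.diagonal (A.slopeAt X) := by
  ext m n
  have hsum : ∀ v, ∑ b, A.l (idx X m) (Pi.single b 1) * v b = A.l (idx X m) v := fun v => by
    conv_rhs => rw [← Finset.univ_sum_single v, map_sum]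
    exact Finset.sum_congr rfl fun b _ => by
      rw [mul_comm, ← smul_eq_mul, ← map_smul, ← Pi.single_smul, smul_eq_mul, mul_one]
  simp only [Matrix.mul_apply, formMatrix, Matrix.of_apply, LinearMap.toMatrix'_apply]
  rw [hsum, l_idx_param, Matrix.diagonal_apply]
  split_ifs with h
  · simp [h]
  · rw [Pi.single_eq_of_ne h, mul_zero]

theorem absDet_mul_coneVolume : A.absDet X * A.coneVolume X = ∏ m, |A.slopeAt X m| := by
  rw [absDet, coneVolume, ← abs_mul, ← LinearMap.det_toMatrix', ← Matrix.det_mul,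
    formMatrix_mul_toMatrix'_param, Matrix.det_diagonal, Finset.abs_prod]

theorem abs_det_formMatrix {φ : Fin k → Fin N} (hmem : ∀ a, φ a ∈ X.1)
    (hsurj : ∀ j ∈ X.1, ∃ a, φ a = j) : |(A.formMatrix φ).det| = A.absDet X := by
  choose p hp using fun a => exists_idx_eq X (hmem a)
  have hp_surj : Function.Surjective p := fun m =>
    (hsurj _ (idx_mem X m)).imp fun a ha => idx_injective X (by rw [hp, ha])
  let e : Fin k ≃ Fin k := Equiv.ofBijective p (Finite.surjective_iff_bijective.1 hp_surj)
  rw [absDet, ← Matrix.abs_det_submatrix_equiv_equiv e (Equiv.refl _) (A.formMatrix (idx X))]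
  congr 2
  ext a b
  simp [formMatrix, e, hp]

/-- The vertex obtained from `X` by exchanging `j_m` for `r`. -/
def exchange (m : Fin k) (r : Fin N) (hr : r ∉ X.1.erase (idx X m)) : ArrVertex k N :=
  ⟨insert r (X.1.erase (idx X m)), by rw [Finset.card_insert_of_notMem hr, card_erase_idx]⟩

theorem formMatrix_update (m : Fin k) (r : Fin N) :
    A.formMatrix (Function.update (idx X) m r) = (A.formMatrix (idx X)).updateRow m
      (∑ n, (A.l r (A.edge X n) / A.slopeAt X n) • A.formMatrix (idx X) n) := by
  ext a b
  rcases eq_or_ne a m with rfl | ha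
  · rw [Matrix.updateRow_self, formMatrix, Matrix.of_apply, Function.update_self,
      ← A.sum_map_edge_mul_coord X (A.l r), Finset.sum_apply]
    refine Finset.sum_congr rfl fun n _ => ?_
    simp only [coord, formMatrix, Pi.smul_apply, Matrix.of_apply, smul_eq_mul]
    ring
  · rw [Matrix.updateRow_ne ha, formMatrix, Matrix.of_apply, Function.update_of_ne ha]
    rfl

theorem absDet_exchange (m : Fin k) {r : Fin N} (hr : r ∉ X.1.erase (idx X m)) :
    A.absDet (exchange X m r hr) * |A.slopeAt X m| = A.absDet X * |A.l r (A.edge X m)| := by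
  rw [← A.abs_det_formMatrix (exchange X m r hr) (φ := Function.update (idx X) m r),
    formMatrix_update, Matrix.det_updateRow_sum, smul_eq_mul, abs_mul, abs_div, absDet]
  · field_simp [abs_ne_zero.2 (A.slopeAt_ne_zero X m)]
  · intro a
    rcases eq_or_ne a m with rfl | ha
    · rw [Function.update_self]
      exact Finset.mem_insert_self _ _
    · rw [Function.update_of_ne ha]
      exact Finset.mem_insert_of_mem ((idx_mem_erase_iff X).2 ha)
  · intro j hj
    rcases Finset.mem_insert.1 hj with rfl | hj
    · exact ⟨m, Function.update_self _ _ _⟩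
    · obtain ⟨n, rfl⟩ := exists_idx_eq X (Finset.mem_of_mem_erase hj)
      exact ⟨n, Function.update_of_ne ((idx_mem_erase_iff X).1 hj) _ _⟩

end AbsDet

section SignedForm

theorem abs_domainSign (j : Fin N) : |A.domainSign X j| = 1 := by
  rw [domainSign]
  split_ifs with hj
  exacts [abs_real_sign_of_ne_zero (A.l_edge_ne X hj),
    abs_real_sign_of_ne_zero (A.f_point_ne X hj)]

theorem domainSign_mul_self (j : Fin N) : A.domainSign X j * A.domainSign X j = 1 := by
  rw [← abs_mul_abs_self, abs_domainSign, one_mul]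

/-- The values `|f_j(X)|`. -/
def absAt (j : Fin N) : ℝ := |A.f j (A.point X)|

theorem absAt_pos : ∀ j ∈ X.1ᶜ, 0 < A.absAt X j := fun _ hj =>
  abs_pos.2 (A.f_point_ne X (Finset.mem_compl.1 hj))

theorem domainSign_mul_f_point (j : Fin N) :
    A.domainSign X j * A.f j (A.point X) = A.absAt X j := by
  rw [domainSign, absAt]
  split_ifs with hj
  · rw [A.point_spec X hj, mul_zero, abs_zero]
  · exact real_sign_mul_self _

/-- The derivatives along the edges at `X` of the forms `f_j`, taken with their signs on `Δ_X`. -/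
def signedSlope (j : Fin N) (m : Fin k) : ℝ := A.domainSign X j * A.l j (A.edge X m)

theorem signedSlope_idx_self (m : Fin k) :
    A.signedSlope X (idx X m) m = |A.slopeAt X m| := by
  rw [signedSlope, domainSign, if_pos (idx_mem X m)]
  exact real_sign_mul_self _

theorem signedSlope_idx_of_ne {m n : Fin k} (h : n ≠ m) : A.signedSlope X (idx X n) m = 0 := by
  rw [signedSlope, l_idx_edge_of_ne A X h, mul_zero]

theorem sum_signedSlope_mul (j : Fin N) (a : Fin k → ℝ) :
    ∑ m, A.signedSlope X j m * a m = A.domainSign X j * A.l j (A.param X a) := by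
  simp only [map_param, Finset.mul_sum, signedSlope, mul_assoc]

/-- The forms `f_j`, taken with their signs on `Δ_X`, at the point of `C_X^ρ` with the linear
coordinates `a`. -/
def signedForm (ρ : ℂ) (a : Fin k → ℝ) (j : Fin N) : ℂ :=
  outerForm (A.absAt X) (A.signedSlope X) ρ a j

theorem complexifyForm_rot_param (g : (Fin k → ℝ) →ᵃ[ℝ] ℝ) (ρ : ℂ) (a : Fin k → ℝ) :
    complexifyForm g (A.rot X ρ (A.point X + A.param X a)) =
      (g (A.point X) : ℂ) + ρ * (g.linear (A.param X a) : ℂ) := by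
  have hre : (fun i => (A.rot X ρ (A.point X + A.param X a) i).re) =
      ρ.re • A.param X a +ᵥ A.point X := by
    ext i
    simp [rot, add_comm]
  have him : (fun i => (A.rot X ρ (A.point X + A.param X a) i).im) = ρ.im • A.param X a := by
    ext i
    simp [rot]
  rw [complexifyForm, hre, him, g.map_vadd, map_smul, map_smul, vadd_eq_add, smul_eq_mul,
    smul_eq_mul]
  apply Complex.ext <;> simp [add_comm]

theorem domainSign_mul_complexifyForm_rot_param (ρ : ℂ) (a : Fin k → ℝ) (j : Fin N) :
    (A.domainSign X j : ℂ) * complexifyForm (A.f j) (A.rot X ρ (A.point X + A.param X a)) =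
      A.signedForm X ρ a j := by
  rw [signedForm, outerForm, sum_signedSlope_mul, ← domainSign_mul_f_point,
    complexifyForm_rot_param, l]
  push_cast
  ring

theorem complexifyForm_rot_param_eq_domainSign_mul (ρ : ℂ) (a : Fin k → ℝ) (j : Fin N) :
    complexifyForm (A.f j) (A.rot X ρ (A.point X + A.param X a)) =
      (A.domainSign X j : ℂ) * A.signedForm X ρ a j := by
  rw [← domainSign_mul_complexifyForm_rot_param, ← mul_assoc, ← Complex.ofReal_mul,
    domainSign_mul_self, Complex.ofReal_one, one_mul]

theorem signedForm_idx (ρ : ℂ) (a : Fin k → ℝ) (m : Fin k) :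
    A.signedForm X ρ a (idx X m) = ((|A.slopeAt X m| * a m : ℝ) : ℂ) * ρ := by
  rw [signedForm, outerForm, absAt, A.point_spec X (idx_mem X m), abs_zero, Complex.ofReal_zero,
    zero_add, mul_comm, Finset.sum_eq_single_of_mem m (Finset.mem_univ m) fun n _ hn => by
      rw [A.signedSlope_idx_of_ne X hn.symm, zero_mul], signedSlope_idx_self]

theorem signedForm_mul (t : ℝ) (ρ : ℂ) (a : Fin k → ℝ) (j : Fin N) :
    A.signedForm X (t * ρ) a j = A.signedForm X ρ (t • a) j := by
  simp only [signedForm, outerForm, Pi.smul_apply, smul_eq_mul, mul_left_comm _ t,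
    ← Finset.mul_sum]
  push_cast
  ring

theorem signedForm_mem_slitPlane {ρ : ℂ} (hρ : ρ.im ≠ 0) {a : Fin k → ℝ} {j : Fin N}
    (ha : ∀ m, idx X m = j → 0 < a m) : A.signedForm X ρ a j ∈ Complex.slitPlane := by
  by_cases hj : j ∈ X.1
  · obtain ⟨m, rfl⟩ := exists_idx_eq X hj
    rw [signedForm_idx, Complex.mem_slitPlane_iff, Complex.im_ofReal_mul]
    exact Or.inr (mul_ne_zero
      (mul_pos (abs_pos.2 (A.slopeAt_ne_zero X m)) (ha m rfl)).ne' hρ)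
  · exact outerForm_mem_slitPlane (A.absAt_pos X j (Finset.mem_compl.2 hj)) hρ a

theorem signedForm_ne_zero {ρ : ℂ} (hρ : ρ.im ≠ 0) {a : Fin k → ℝ} (ha : a ∈ posOrthant k)
    (j : Fin N) : A.signedForm X ρ a j ≠ 0 :=
  Complex.slitPlane_ne_zero (A.signedForm_mem_slitPlane X hρ fun m _ => ha m)

end SignedForm

section ConeIntegral

/-- `e^{-λ (f₀ - f₀(X))} ∏_j |f_j|^{β_j}` at the point of `C_X^ρ` with the linear
coordinates `a`. -/
def pullback (β : Fin N → ℝ) (lam ρ : ℂ) (a : Fin k → ℝ) : ℂ :=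
  Complex.exp (-(lam * ρ) * ((∑ m, a m : ℝ) : ℂ)) * ∏ j, A.signedForm X ρ a j ^ (β j : ℂ)

/-- `∫_{C_X^ρ} e^{-λ (f₀ - f₀(X))} ∏_j |f_j|^{β_j}` in the linear coordinates of the cone, up to the
constant `coneVolume`; `ρ ^ k` is the Jacobian of the rotation. -/
def coneIntegral (β : Fin N → ℝ) (lam ρ : ℂ) : ℂ :=
  ∫ a in posOrthant k, ρ ^ k * A.pullback X β lam ρ a

/-- The constant that the scaling `|l_{j_m}(e_{X ∖ {j_m}})| ρ` of the `m`-th coordinate contributes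
to `coneIntegral`, over all `m`. -/
def coneFactor (β : Fin N → ℝ) (ρ : ℂ) : ℂ :=
  ∏ m, ((|A.slopeAt X m| ^ β (idx X m) : ℝ) : ℂ) * ρ ^ ((β (idx X m) + 1 : ℝ) : ℂ)

/-- `laplaceCore` for the forms `f_j`, `j ∉ X`, in the linear coordinates of the cone. -/
def core (β : Fin N → ℝ) (μ ρ : ℂ) : (Fin k → ℝ) → ℂ :=
  laplaceCore X.1ᶜ (A.absAt X) (A.signedSlope X) (β ∘ idx X) β μ ρ

variable {β : Fin N → ℝ} {lam ρ : ℂ}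

theorem pow_mul_pullback (β : Fin N → ℝ) (lam : ℂ) (hρ : ρ ≠ 0) {a : Fin k → ℝ}
    (ha : a ∈ posOrthant k) :
    ρ ^ k * A.pullback X β lam ρ a = A.coneFactor X β ρ * A.core X β (lam * ρ) ρ a := by
  have hpow : ρ ^ k = ∏ _m : Fin k, ρ := by simp
  have hexp : Complex.exp (-(lam * ρ) * ((∑ m, a m : ℝ) : ℂ)) =
      ∏ m, Complex.exp (-(lam * ρ) * (a m : ℂ)) := by
    rw [Complex.ofReal_sum, Finset.mul_sum, Complex.exp_sum]
  have hfactor : ∀ m, ρ * (Complex.exp (-(lam * ρ) * (a m : ℂ)) *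
      A.signedForm X ρ a (idx X m) ^ (β (idx X m) : ℂ)) =
      (((|A.slopeAt X m| ^ β (idx X m) : ℝ) : ℂ) * ρ ^ ((β (idx X m) + 1 : ℝ) : ℂ)) *
        (((a m ^ (β ∘ idx X) m : ℝ) : ℂ) * Complex.exp (-(lam * ρ) * (a m : ℂ))) := fun m => by
    have hs := abs_pos.2 (A.slopeAt_ne_zero X m)
    have hsa := mul_pos hs (ha m)
    rw [signedForm_idx, ofReal_mul_cpow hsa hρ, ← Complex.ofReal_cpow hsa.le,
      Real.mul_rpow hs.le (ha m).le, Complex.ofReal_add, Complex.ofReal_one,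
      Complex.cpow_add _ _ hρ, Complex.cpow_one, Function.comp_apply, Complex.ofReal_mul]
    ring
  rw [pullback, ← Finset.prod_mul_prod_compl X.1, ← prod_idx X, hexp, hpow,
    ← mul_assoc (∏ m, Complex.exp _), ← Finset.prod_mul_distrib, ← mul_assoc,
    ← Finset.prod_mul_distrib, Finset.prod_congr rfl fun m _ => hfactor m,
    Finset.prod_mul_distrib, mul_assoc]
  rfl

theorem integrableOn_core (hβ : ∀ m, -1 < β (idx X m)) {μ : ℂ} (hμ : 0 < μ.re) (hρ : ρ.im ≠ 0) :
    IntegrableOn (A.core X β μ ρ) (posOrthant k) :=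
  integrableOn_laplaceCore (A.absAt_pos X) hβ hμ hρ

theorem integrableOn_pow_mul_pullback (hβ : ∀ m, -1 < β (idx X m)) (hlam : 0 < (lam * ρ).re)
    (hρ : ρ.im ≠ 0) : IntegrableOn (fun a => ρ ^ k * A.pullback X β lam ρ a) (posOrthant k) :=
  IntegrableOn.congr_fun ((A.integrableOn_core X hβ hlam hρ).const_mul (A.coneFactor X β ρ))
    (fun _ ha => (A.pow_mul_pullback X β lam (norm_pos_iff.1 (norm_pos_of_im_ne_zero hρ)) ha).symm)
    (measurableSet_posOrthant k)

theorem coneIntegral_eq_coneFactor_mul (β : Fin N → ℝ) (lam : ℂ) (hρ : ρ ≠ 0) :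
    A.coneIntegral X β lam ρ =
      A.coneFactor X β ρ * ∫ a in posOrthant k, A.core X β (lam * ρ) ρ a := by
  rw [coneIntegral, setIntegral_congr_fun (measurableSet_posOrthant k)
    fun _ ha => A.pow_mul_pullback X β lam hρ ha, integral_const_mul]

theorem coneIntegral_ofReal_mul (β : Fin N → ℝ) (lam ρ : ℂ) {t : ℝ} (ht : 0 < t) :
    A.coneIntegral X β lam (t * ρ) = A.coneIntegral X β lam ρ := by
  have hpull : ∀ a, A.pullback X β lam (t * ρ) a = A.pullback X β lam ρ (t • a) := fun a => by
    simp only [pullback, signedForm_mul, Pi.smul_apply, smul_eq_mul, ← Finset.mul_sum]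
    push_cast
    ring_nf
  have ht' : (t : ℂ) ^ k ≠ 0 := pow_ne_zero k (Complex.ofReal_ne_zero.2 ht.ne')
  simp only [coneIntegral, hpull, mul_pow, mul_assoc, integral_const_mul]
  rw [Measure.setIntegral_comp_smul_of_pos volume _ _ ht, smul_posOrthant ht,
    Module.finrank_fin_fun, Complex.real_smul, Complex.ofReal_inv, Complex.ofReal_pow,
    mul_left_comm _ (_⁻¹), mul_inv_cancel_left₀ ht']

theorem differentiableAt_coneIntegral (hβ : ∀ m, -1 < β (idx X m)) (hlam : 0 < (lam * ρ).re)
    (hρ : ρ.im ≠ 0) : DifferentiableAt ℂ (A.coneIntegral X β lam) ρ := by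
  have hslit : ρ ∈ Complex.slitPlane := Complex.mem_slitPlane_iff.2 (Or.inr hρ)
  have hcore : DifferentiableAt ℂ
      (fun z => ∫ a in posOrthant k, A.core X β (lam * z) z a) ρ :=
    (hasDerivAt_integral_laplaceCore (A.absAt_pos X) hβ (u := fun z => lam * z) (v := fun z => z)
      (by fun_prop) (by fun_prop) hlam hρ).differentiableAt
  have hfactor : DifferentiableAt ℂ (A.coneFactor X β) ρ :=
    DifferentiableAt.fun_finsetProd fun m _ =>
      (differentiableAt_id.cpow_const hslit).const_mul _
  refine (hfactor.mul hcore).congr_of_eventuallyEq ?_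
  filter_upwards [eventually_ne_nhds (Complex.slitPlane_ne_zero hslit)] with z hz
  exact A.coneIntegral_eq_coneFactor_mul X β lam hz

/-- The directions `ρ` of the rotated cones admitted for `I^±(λ)`, of any length. -/
def wedge (σ : ℝ) (lam : ℂ) : Set ℂ := {ρ | σ * ρ.im < 0 ∧ 0 < (lam * ρ).re}

theorem isOpen_wedge (σ : ℝ) (lam : ℂ) : IsOpen (wedge σ lam) :=
  (isOpen_lt (continuous_const.mul Complex.continuous_im) continuous_const).inter
    (isOpen_lt continuous_const (Complex.continuous_re.comp (continuous_const_mul lam)))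

theorem convex_wedge (σ : ℝ) (lam : ℂ) : Convex ℝ (wedge σ lam) := by
  refine Convex.inter (convex_halfSpace_lt (f := fun ρ : ℂ => σ * ρ.im) ?_ 0)
    (convex_halfSpace_gt (f := fun ρ : ℂ => (lam * ρ).re) ?_ 0)
  · exact ⟨fun x y => by simp [mul_add], fun c x => by simp [mul_left_comm]⟩
  · exact ⟨fun x y => by simp only [mul_add, Complex.add_re], fun c x => by
      rw [mul_smul_comm, Complex.smul_re]⟩

theorem im_ne_zero_of_mem_wedge {σ : ℝ} (hρ : ρ ∈ wedge σ lam) : ρ.im ≠ 0 := fun h => by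
  simpa [h] using hρ.1

theorem coneIntegral_eq_of_mem_wedge (hβ : ∀ m, -1 < β (idx X m)) {σ : ℝ} {ρ' : ℂ}
    (hρ : ρ ∈ wedge σ lam) (hρ' : ρ' ∈ wedge σ lam) :
    A.coneIntegral X β lam ρ = A.coneIntegral X β lam ρ' :=
  eq_of_differentiableOn_of_map_real_mul (isOpen_wedge σ lam) (convex_wedge σ lam)
    (by simp [wedge])
    (fun _ h => (A.differentiableAt_coneIntegral X hβ h.2
      (im_ne_zero_of_mem_wedge h)).differentiableWithinAt)
    (fun z _ _ ht => A.coneIntegral_ofReal_mul X β lam z ht) hρ hρ'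

end ConeIntegral

section Solution

variable {α : Fin N → ℝ} {lam ρ : ℂ} {σ : ℝ}

/-- The exponents of `(∏_j |f_j|^{α_j}) / ∏_{j ∈ U} |f_j|`. -/
def lower (α : Fin N → ℝ) (U : Finset (Fin N)) (j : Fin N) : ℝ := if j ∈ U then α j - 1 else α j

theorem neg_one_lt_lower (hα : ∀ j, 0 < α j) (U : Finset (Fin N)) (j : Fin N) :
    -1 < lower α U j := by
  have := hα j
  rw [lower]
  split_ifs <;> linarith

theorem lower_insert (α : Fin N → ℝ) {U : Finset (Fin N)} {r : Fin N} (hr : r ∉ U) :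
    lower α (insert r U) = lower α U - Pi.single r 1 := by
  ext j
  rcases eq_or_ne j r with rfl | hj
  · simp [lower, hr]
  · simp [lower, hj]

theorem pullback_sub_single (β : Fin N → ℝ) (lam ρ : ℂ) (a : Fin k → ℝ) (r : Fin N) :
    A.pullback X (β - Pi.single r 1) lam ρ a =
      Complex.exp (-(lam * ρ) * ((∑ m, a m : ℝ) : ℂ)) *
        ((∏ j ∈ Finset.univ.erase r, A.signedForm X ρ a j ^ (β j : ℂ)) *
          A.signedForm X ρ a r ^ ((β r : ℂ) - 1)) := by
  rw [pullback, ← Finset.prod_erase_mul _ _ (Finset.mem_univ r)]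
  congr 2
  · refine Finset.prod_congr rfl fun j hj => ?_
    rw [Pi.sub_apply, Pi.single_eq_of_ne (Finset.ne_of_mem_erase hj), sub_zero]
  · rw [Pi.sub_apply, Pi.single_eq_same, Complex.ofReal_sub, Complex.ofReal_one]

theorem pullback_eq_signedForm_mul (β : Fin N → ℝ) (lam : ℂ) {a : Fin k → ℝ} {r : Fin N}
    (hr : A.signedForm X ρ a r ≠ 0) :
    A.pullback X β lam ρ a =
      A.signedForm X ρ a r * A.pullback X (β - Pi.single r 1) lam ρ a := by
  rw [pullback_sub_single, pullback, ← Finset.prod_erase_mul _ _ (Finset.mem_univ r),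
    Complex.cpow_sub _ _ hr, Complex.cpow_one]
  field_simp

theorem pullback_eq_prod_signedForm_mul (α : Fin N → ℝ) (U : Finset (Fin N)) (lam : ℂ)
    (hρ : ρ.im ≠ 0) {a : Fin k → ℝ} (ha : a ∈ posOrthant k) :
    A.pullback X α lam ρ a =
      (∏ j ∈ U, A.signedForm X ρ a j) * A.pullback X (lower α U) lam ρ a := by
  induction U using Finset.induction_on with
  | empty =>
    have : lower α ∅ = α := by ext; simp [lower]
    rw [Finset.prod_empty, one_mul, this]
  | insert r U hr ih =>
    rw [ih, A.pullback_eq_signedForm_mul X _ lam (A.signedForm_ne_zero X hρ ha r),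
      Finset.prod_insert hr, lower_insert α hr]
    ring

/-- The sign of `∏_{j ∈ U} f_j` on `Δ_X`. -/
def signOn (U : Finset (Fin N)) : ℝ := ∏ j ∈ U, A.domainSign X j

theorem signOn_mul_self (U : Finset (Fin N)) : A.signOn X U * A.signOn X U = 1 := by
  rw [signOn, ← Finset.prod_mul_distrib]
  exact Finset.prod_eq_one fun j _ => A.domainSign_mul_self X j

/-- The constant by which `I^ρ_{X,X'}(λ)` differs from `coneIntegral`. -/
def prefactor (X' : ArrVertex k N) (lam : ℂ) : ℂ :=
  (A.signOn X X'.1 * A.absDet X' : ℝ) * Complex.exp (-lam * (A.f0 (A.point X) : ℂ))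

theorem integrand_param (α : Fin N → ℝ) (hρ : ρ.im ≠ 0) (X' : ArrVertex k N) (lam : ℂ)
    {a : Fin k → ℝ} (ha : a ∈ posOrthant k) :
    A.integrand α ρ X X' lam (A.point X + A.param X a) =
      A.prefactor X X' lam * (ρ ^ k * A.pullback X (lower α X'.1) lam ρ a) := by
  have hexp : Complex.exp (-lam * complexifyForm A.f0.toAffineMap
      (A.rot X ρ (A.point X + A.param X a))) = Complex.exp (-lam * (A.f0 (A.point X) : ℂ)) *
        Complex.exp (-(lam * ρ) * ((∑ m, a m : ℝ) : ℂ)) := by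
    rw [complexifyForm_rot_param, LinearMap.toAffineMap_linear, f0_param, ← Complex.exp_add,
      LinearMap.coe_toAffineMap]
    ring_nf
  have hbranch : Complex.exp (-(lam * ρ) * ((∑ m, a m : ℝ) : ℂ)) *
      A.branch α X (A.rot X ρ (A.point X + A.param X a)) =
        (∏ j ∈ X'.1, A.signedForm X ρ a j) * A.pullback X (lower α X'.1) lam ρ a := by
    rw [← A.pullback_eq_prod_signedForm_mul X α X'.1 lam hρ ha]
    simp only [branch, domainSign_mul_complexifyForm_rot_param, pullback]
  have homega : A.omega X' (A.rot X ρ (A.point X + A.param X a)) =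
      (A.absDet X' : ℂ) * ((A.signOn X X'.1 : ℂ) / ∏ j ∈ X'.1, A.signedForm X ρ a j) := by
    have hsign : (A.signOn X X'.1 : ℂ) * A.signOn X X'.1 = 1 :=
      mod_cast A.signOn_mul_self X X'.1
    simp only [omega, complexifyForm_rot_param_eq_domainSign_mul, Finset.prod_mul_distrib,
      ← Complex.ofReal_prod]
    change (A.absDet X' : ℂ) / ((A.signOn X X'.1 : ℂ) * _) = _
    rw [← div_div, div_eq_mul_inv (A.absDet X' : ℂ), inv_eq_of_mul_eq_one_left hsign,
      mul_div_assoc]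
  have hne : ∏ j ∈ X'.1, A.signedForm X ρ a j ≠ 0 :=
    Finset.prod_ne_zero_iff.2 fun j _ => A.signedForm_ne_zero X hρ ha j
  rw [integrand, hexp, mul_assoc (Complex.exp _), hbranch, homega, prefactor, Complex.ofReal_mul]
  field_simp

theorem integrableOn_integrand (hα : ∀ j, 0 < α j) (hρ : ρ.im ≠ 0) (X' : ArrVertex k N)
    (hlam : 0 < (lam * ρ).re) : IntegrableOn (A.integrand α ρ X X' lam) (A.cone X) :=
  A.integrableOn_cone X (IntegrableOn.congr_fun
    ((A.integrableOn_pow_mul_pullback X (fun _ => neg_one_lt_lower hα X'.1 _) hlam hρ).const_mul _)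
    (fun _ ha => (A.integrand_param X α hρ X' lam ha).symm) (measurableSet_posOrthant k))

theorem rhoIntegral_eq_prefactor_mul (α : Fin N → ℝ) (hρ : ρ.im ≠ 0) (X' : ArrVertex k N)
    (lam : ℂ) : A.rhoIntegral α ρ X X' lam =
      (A.coneVolume X : ℂ) * (A.prefactor X X' lam * A.coneIntegral X (lower α X'.1) lam ρ) := by
  rw [rhoIntegral, setIntegral_cone, setIntegral_congr_fun (measurableSet_posOrthant k)
    fun _ ha => A.integrand_param X α hρ X' lam ha, integral_const_mul, coneIntegral]

theorem rhoIntegral_eq_of_mem_wedge (hα : ∀ j, 0 < α j) (X' : ArrVertex k N) {ρ' : ℂ}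
    (hρ : ρ ∈ wedge σ lam) (hρ' : ρ' ∈ wedge σ lam) :
    A.rhoIntegral α ρ X X' lam = A.rhoIntegral α ρ' X X' lam := by
  rw [A.rhoIntegral_eq_prefactor_mul X α (im_ne_zero_of_mem_wedge hρ),
    A.rhoIntegral_eq_prefactor_mul X α (im_ne_zero_of_mem_wedge hρ'),
    A.coneIntegral_eq_of_mem_wedge X (fun _ => neg_one_lt_lower hα X'.1 _) hρ hρ']

theorem Admissible.mem_wedge (h : Admissible σ lam ρ) : ρ ∈ wedge σ lam :=
  ⟨h.2.1, mul_comm ρ lam ▸ h.2.2⟩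

theorem exists_admissible (hρ : ρ ∈ wedge σ lam) : ∃ ρ', Admissible σ lam ρ' := by
  have hpos := norm_pos_of_im_ne_zero (im_ne_zero_of_mem_wedge hρ)
  refine ⟨(‖ρ‖⁻¹ : ℝ) * ρ, ?_, ?_, ?_⟩
  · rw [norm_mul, Complex.norm_real, norm_inv, norm_norm, inv_mul_cancel₀ hpos.ne']
  · rw [Complex.im_ofReal_mul, mul_left_comm]
    exact mul_neg_of_pos_of_neg (inv_pos.2 hpos) hρ.1
  · rw [mul_assoc, Complex.re_ofReal_mul, mul_comm ρ]
    exact mul_pos (inv_pos.2 hpos) hρ.2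

theorem solution_eq_rhoIntegral (hα : ∀ j, 0 < α j) (X' : ArrVertex k N)
    (hρ : ρ ∈ wedge σ lam) : A.solution α σ X lam X' = A.rhoIntegral α ρ X X' lam := by
  have hex : ∃ c : ℂ, ∀ ρ, Admissible σ lam ρ → A.rhoIntegral α ρ X X' lam = c :=
    ⟨_, fun _ h => A.rhoIntegral_eq_of_mem_wedge X hα X' h.mem_wedge hρ⟩
  obtain ⟨ρ', hρ'⟩ := exists_admissible hρ
  rw [solution, ← Classical.epsilon_spec hex ρ' hρ',
    A.rhoIntegral_eq_of_mem_wedge X hα X' hρ'.mem_wedge hρ]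

end Solution


section IntegrationByParts

variable {α β : Fin N → ℝ} {lam ρ : ℂ}

theorem hasDerivAt_signedForm_update (ρ : ℂ) (a : Fin k → ℝ) (m : Fin k) (j : Fin N) :
    HasDerivAt (fun t => A.signedForm X ρ (Function.update a m t) j)
      (ρ * A.signedSlope X j m) (a m) := by
  have hsum : HasDerivAt (fun t => ∑ n, A.signedSlope X j n * Function.update a m t n)
      (A.signedSlope X j m) (a m) := by
    refine (HasDerivAt.fun_sum fun n _ => (hasDerivAt_pi.1
      (hasDerivAt_update a m (a m)) n).const_mul (A.signedSlope X j n)).congr_deriv ?_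
    simp [Pi.single_apply]
  exact (hsum.ofReal_comp.const_mul ρ).const_add _

theorem hasDerivAt_exp_mul_sum_update (c : ℂ) (a : Fin k → ℝ) (m : Fin k) :
    HasDerivAt (fun t => Complex.exp (-c * ((∑ n, Function.update a m t n : ℝ) : ℂ)))
      (-c * Complex.exp (-c * ((∑ n, a n : ℝ) : ℂ))) (a m) := by
  have hsum : HasDerivAt (fun t => ∑ n, Function.update a m t n) 1 (a m) := by
    refine (HasDerivAt.fun_sum fun n _ =>
      hasDerivAt_pi.1 (hasDerivAt_update a m (a m)) n).congr_deriv ?_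
    simp [Pi.single_apply]
  refine (hsum.ofReal_comp.const_mul (-c)).cexp.congr_deriv ?_
  rw [Function.update_eq_self, Complex.ofReal_one, mul_one, mul_comm]

theorem hasDerivAt_pullback_update (β : Fin N → ℝ) (lam : ℂ) (hρ : ρ.im ≠ 0) {a : Fin k → ℝ}
    (ha : a ∈ posOrthant k) (m : Fin k) :
    HasDerivAt (fun t => A.pullback X β lam ρ (Function.update a m t))
      (ρ * (∑ r, ((β r * A.signedSlope X r m : ℝ) : ℂ) *
        A.pullback X (β - Pi.single r 1) lam ρ a - lam * A.pullback X β lam ρ a)) (a m) := by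
  have hpow : ∀ r ∈ Finset.univ, HasDerivAt
      (fun t => A.signedForm X ρ (Function.update a m t) r ^ (β r : ℂ))
      (β r * A.signedForm X ρ a r ^ ((β r : ℂ) - 1) * (ρ * A.signedSlope X r m)) (a m) :=
    fun r _ => by
      have hslit : A.signedForm X ρ (Function.update a m (a m)) r ∈ Complex.slitPlane := by
        rw [Function.update_eq_self]
        exact A.signedForm_mem_slitPlane X hρ fun n _ => ha n
      have := (Complex.hasStrictDerivAt_cpow_const (c := β r) hslit).hasDerivAt.comp (a m)
        (A.hasDerivAt_signedForm_update X ρ a m r)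
      rwa [Function.update_eq_self] at this
  refine ((hasDerivAt_exp_mul_sum_update (lam * ρ) a m).fun_mul
    (HasDerivAt.fun_finsetProd hpow)).congr_deriv ?_
  simp only [pullback_sub_single]
  simp only [Function.update_eq_self, smul_eq_mul, mul_sub, Finset.mul_sum, pullback]
  rw [add_comm, sub_eq_add_neg]
  congr 1
  · refine Finset.sum_congr rfl fun r _ => ?_
    push_cast
    ring
  · ring

theorem tendsto_pullback_update_zero (lam : ℂ) (hρ : ρ.im ≠ 0) {a : Fin k → ℝ}
    (ha : a ∈ posOrthant k) {m : Fin k} (hβ : 0 < β (idx X m)) :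
    Tendsto (fun t => A.pullback X β lam ρ (Function.update a m t)) (𝓝[>] 0) (𝓝 0) := by
  have hzero : A.signedForm X ρ (Function.update a m 0) (idx X m) = 0 := by
    rw [signedForm_idx, Function.update_self, mul_zero, Complex.ofReal_zero, zero_mul]
  have hform (j : Fin N) :
      Continuous fun t : ℝ => A.signedForm X ρ (Function.update a m t) j := by
    unfold signedForm outerForm
    fun_prop
  have hfactor : ∀ j, ContinuousAt
      (fun t : ℝ => A.signedForm X ρ (Function.update a m t) j ^ (β j : ℂ)) 0 := fun j => by
    rcases eq_or_ne j (idx X m) with rfl | hj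
    · refine ContinuousAt.comp (g := fun z : ℂ => z ^ (β (idx X m) : ℂ)) ?_
        (hform _).continuousAt
      exact Complex.continuousAt_cpow_const_of_re_pos (Or.inl (by rw [hzero, Complex.zero_re]))
        (by rwa [Complex.ofReal_re])
    · refine (hform j).continuousAt.cpow continuousAt_const
        (A.signedForm_mem_slitPlane X hρ fun n hn => ?_)
      rw [Function.update_of_ne fun h => hj (by rw [← hn, h])]
      exact ha n
  have hcont : ContinuousAt (fun t => A.pullback X β lam ρ (Function.update a m t)) 0 := by
    unfold pullback
    exact ContinuousAt.mul (by fun_prop) (tendsto_finsetProd _ fun j _ => hfactor j)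
  have hval : A.pullback X β lam ρ (Function.update a m 0) = 0 := by
    rw [pullback, Finset.prod_eq_zero (Finset.mem_univ (idx X m)), mul_zero]
    rw [hzero, Complex.zero_cpow (Complex.ofReal_ne_zero.2 hβ.ne')]
  exact (hval ▸ hcont.tendsto).mono_left nhdsWithin_le_nhds

theorem mul_coneIntegral_eq_sum_signedSlope (hβ : ∀ n, -1 < β (idx X n)) {m : Fin k}
    (hm : 0 < β (idx X m)) (hlam : 0 < (lam * ρ).re) (hρ : ρ.im ≠ 0) :
    lam * A.coneIntegral X β lam ρ = ∑ r, ((β r * A.signedSlope X r m : ℝ) : ℂ) *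
      A.coneIntegral X (β - Pi.single r 1) lam ρ := by
  have hint := A.integrableOn_pow_mul_pullback X hβ hlam hρ
  have hint' : ∀ r, IntegrableOn (fun a => ((β r * A.signedSlope X r m : ℝ) : ℂ) *
      (ρ ^ k * A.pullback X (β - Pi.single r 1) lam ρ a)) (posOrthant k) := fun r => by
    by_cases hr : A.signedSlope X r m = 0
    · simp [hr]
    refine (A.integrableOn_pow_mul_pullback X (fun n => ?_) hlam hρ).const_mul _
    rcases eq_or_ne (idx X n) r with rfl | hn
    · obtain rfl : n = m := by_contra fun h => hr (A.signedSlope_idx_of_ne X h)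
      rw [Pi.sub_apply, Pi.single_eq_same]
      linarith
    · rw [Pi.sub_apply, Pi.single_eq_of_ne hn, sub_zero]
      exact hβ n
  have hsum : IntegrableOn (fun a => ∑ r, ((β r * A.signedSlope X r m : ℝ) : ℂ) *
      (ρ ^ k * A.pullback X (β - Pi.single r 1) lam ρ a)) (posOrthant k) :=
    integrable_finsetSum _ fun r _ => hint' r
  have hzero := setIntegral_posOrthant_eq_zero_of_hasDerivAt_update m hint
    ((hsum.sub (hint.const_mul lam)).const_mul ρ)
    (fun a ha => by
      refine ((A.hasDerivAt_pullback_update X β lam hρ ha m).const_mul (ρ ^ k)).congr_deriv ?_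
      simp only [Pi.sub_apply, mul_sub, Finset.mul_sum]
      congr 1
      · exact Finset.sum_congr rfl fun r _ => by ring
      · ring)
    (fun a ha => by
      simpa using (A.tendsto_pullback_update_zero X lam hρ ha hm).const_mul (ρ ^ k))
  simp only [integral_const_mul, mul_eq_zero, norm_pos_iff.1 (norm_pos_of_im_ne_zero hρ),
    false_or, Pi.sub_apply] at hzero
  rw [integral_sub hsum (hint.const_mul lam), sub_eq_zero,
    integral_finsetSum _ fun r _ => hint' r] at hzero
  simp only [integral_const_mul] at hzero
  simp only [coneIntegral, integral_const_mul]
  exact hzero.symm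

-- The coordinates of `e_U` at `X` sum to `1`, so averaging with them the integrations by parts in
-- the single coordinates gives an integration by parts along `e_U`.
theorem mul_coneIntegral_lower_eq_sum_univ (hα : ∀ j, 0 < α j) {U : Finset (Fin N)}
    (hU : U.card + 1 = k) (hlam : 0 < (lam * ρ).re) (hρ : ρ.im ≠ 0) :
    lam * A.coneIntegral X (lower α U) lam ρ =
      ∑ r, ((A.domainSign X r * A.l r (A.edgeVec U) * lower α U r : ℝ) : ℂ) *
        A.coneIntegral X (lower α U - Pi.single r 1) lam ρ := by
  obtain ⟨hl, hf0⟩ := A.edgeVec_spec U hU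
  set τ := A.coord X (A.edgeVec U) with hτ
  have hsum : ∑ m, τ m = 1 := by
    rw [← hf0, ← A.sum_map_edge_mul_coord X A.f0]
    simp only [f0_edge_eq_one, one_mul, hτ]
  have hslope : ∀ r, ∑ m, A.signedSlope X r m * τ m =
      A.domainSign X r * A.l r (A.edgeVec U) := fun r => by
    rw [sum_signedSlope_mul, param_coord]
  have hcoord : ∀ m, (τ m : ℂ) * (lam * A.coneIntegral X (lower α U) lam ρ) = τ m *
      ∑ r, ((lower α U r * A.signedSlope X r m : ℝ) : ℂ) *
        A.coneIntegral X (lower α U - Pi.single r 1) lam ρ := fun m => by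
    by_cases hm : idx X m ∈ U
    · have : τ m = 0 := by rw [hτ, coord, hl _ hm, zero_div]
      rw [this, Complex.ofReal_zero, zero_mul, zero_mul]
    · rw [A.mul_coneIntegral_eq_sum_signedSlope X (fun _ => neg_one_lt_lower hα U _) (m := m)
        (by rw [lower, if_neg hm]; exact hα _) hlam hρ]
  have haverage : lam * A.coneIntegral X (lower α U) lam ρ =
      ((∑ m, τ m : ℝ) : ℂ) * (lam * A.coneIntegral X (lower α U) lam ρ) := by
    rw [hsum, Complex.ofReal_one, one_mul]
  rw [haverage, Complex.ofReal_sum, Finset.sum_mul, Finset.sum_congr rfl fun m _ => hcoord m]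
  simp only [Finset.mul_sum]
  rw [Finset.sum_comm]
  refine Finset.sum_congr rfl fun r _ => ?_
  rw [← hslope, Finset.sum_mul, Complex.ofReal_sum, Finset.sum_mul]
  refine Finset.sum_congr rfl fun m _ => ?_
  push_cast
  ring

theorem mul_coneIntegral_lower_eq_sum_compl (hα : ∀ j, 0 < α j) {U : Finset (Fin N)}
    (hU : U.card + 1 = k) (hlam : 0 < (lam * ρ).re) (hρ : ρ.im ≠ 0) :
    lam * A.coneIntegral X (lower α U) lam ρ =
      ∑ r ∈ Uᶜ, ((A.domainSign X r * A.l r (A.edgeVec U) * α r : ℝ) : ℂ) *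
        A.coneIntegral X (lower α (insert r U)) lam ρ := by
  rw [A.mul_coneIntegral_lower_eq_sum_univ X hα hU hlam hρ, ← Finset.sum_add_sum_compl U,
    Finset.sum_eq_zero fun r hr => ?_, zero_add]
  · refine Finset.sum_congr rfl fun r hr => ?_
    have hr := Finset.mem_compl.1 hr
    rw [lower_insert α hr, lower, if_neg hr]
  · rw [(A.edgeVec_spec U hU).1 r hr, mul_zero, zero_mul, Complex.ofReal_zero, zero_mul]

end IntegrationByParts

end GenericArrangement

theorem sign_mul_abs_div_abs (a b : ℝ) : Real.sign (a * b) * (|b| / |a|) = b / a := by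
  rcases eq_or_ne a 0 with rfl | ha
  · simp
  have hab : |b| / |a| = |a * b| / (a * a) := by
    rw [abs_mul, ← abs_mul_abs_self a, mul_div_mul_left _ _ (abs_ne_zero.2 ha)]
  rw [hab, ← mul_div_assoc, real_sign_mul_abs, mul_div_mul_left _ _ ha]

theorem insert_erase_eq_iff {ι : Type*} [DecidableEq ι] {s t : Finset ι} {j r : ι} (hst : s ≠ t)
    (hj : j ∈ s) (hr : r ∉ s.erase j) : insert r (s.erase j) = t ↔ s \ t = {j} ∧ t \ s = {r} := by
  constructor
  · rintro rfl
    have hrj : r ≠ j := fun h => hst (by rw [h, Finset.insert_erase hj])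
    constructor <;> ext x <;> grind
  · rintro ⟨hs, ht⟩
    ext x
    have hxs := Finset.ext_iff.1 hs x
    have hxt := Finset.ext_iff.1 ht x
    grind

namespace GenericArrangement

variable {k N : ℕ} (A : GenericArrangement k N) (X : ArrVertex k N)

section ResidueMatrix

/-- The entry of the residue matrix for a step along the line `L_U` that replaces `j` by `r`. -/
def exchangeWeight (α : Fin N → ℝ) (U : Finset (Fin N)) (j r : Fin N) : ℝ :=
  Real.sign (A.l j (A.edgeVec U) * A.l r (A.edgeVec U)) * α r

theorem matB_self (α : Fin N → ℝ) : A.matB α X X =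
    ∑ j ∈ X.1, ∑ r ∈ (X.1.erase j)ᶜ, if insert r (X.1.erase j) = X.1 then
      (A.exchangeWeight α (X.1.erase j) j r : ℂ) else 0 := by
  rw [matB, Matrix.of_apply, if_pos rfl, weight, Complex.ofReal_sum]
  refine Finset.sum_congr rfl fun j hj => ?_
  rw [Finset.sum_eq_single_of_mem j (Finset.mem_compl.2 (Finset.notMem_erase j X.1)),
    if_pos (Finset.insert_erase hj), exchangeWeight,
    Real.sign_of_pos (mul_self_pos.2 (A.l_edge_ne X hj)), one_mul]
  intro r hr hrj
  refine if_neg fun h => Finset.mem_compl.1 hr (Finset.mem_erase.2 ⟨hrj, ?_⟩)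
  rw [← h]
  exact Finset.mem_insert_self _ _

theorem card_inter_add_one_eq_iff (Y : ArrVertex k N) :
    (X.1 ∩ Y.1).card + 1 = k ↔ ∃ j r, X.1 \ Y.1 = {j} ∧ Y.1 \ X.1 = {r} := by
  have hX := Finset.card_sdiff_add_card_inter X.1 Y.1
  have hY := Finset.card_sdiff_add_card_inter Y.1 X.1
  rw [X.2] at hX
  rw [Finset.inter_comm, Y.2] at hY
  constructor
  · intro h
    obtain ⟨j, hj⟩ := Finset.card_eq_one.1 (show (X.1 \ Y.1).card = 1 by omega)
    obtain ⟨r, hr⟩ := Finset.card_eq_one.1 (show (Y.1 \ X.1).card = 1 by omega)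
    exact ⟨j, r, hj, hr⟩
  · rintro ⟨j, r, hj, -⟩
    rw [hj, Finset.card_singleton] at hX
    omega

theorem matB_apply_of_ne (α : Fin N → ℝ) {Y : ArrVertex k N} (hXY : X ≠ Y) : A.matB α X Y =
    ∑ j ∈ X.1, ∑ r ∈ (X.1.erase j)ᶜ, if insert r (X.1.erase j) = Y.1 then
      (A.exchangeWeight α (X.1.erase j) j r : ℂ) else 0 := by
  have hiff : ∀ j ∈ X.1, ∀ r ∈ (X.1.erase j)ᶜ, insert r (X.1.erase j) = Y.1 ↔
      X.1 \ Y.1 = {j} ∧ Y.1 \ X.1 = {r} := fun j hj r hr =>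
    insert_erase_eq_iff (fun h => hXY (Subtype.ext h)) hj (Finset.mem_compl.1 hr)
  rw [matB, Matrix.of_apply, if_neg hXY]
  split_ifs with hcard
  · obtain ⟨j, r, hj, hr⟩ := (card_inter_add_one_eq_iff X Y).1 hcard
    have hjX : j ∈ X.1 := (Finset.mem_sdiff.1 (hj ▸ Finset.mem_singleton_self j)).1
    have hrX : r ∉ X.1 := (Finset.mem_sdiff.1 (hr ▸ Finset.mem_singleton_self r)).2
    have hr' : r ∈ (X.1.erase j)ᶜ := Finset.mem_compl.2 fun h => hrX (Finset.mem_of_mem_erase h)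
    have hinter : X.1 ∩ Y.1 = X.1.erase j := by
      rw [← Finset.sdiff_singleton_eq_erase, ← hj, sdiff_sdiff_right_self, Finset.inf_eq_inter]
    rw [hj, hr, Finset.sum_singleton, Finset.sum_singleton, hinter,
      Finset.sum_eq_single_of_mem j hjX, Finset.sum_eq_single_of_mem r hr',
      if_pos ((hiff j hjX r hr').2 ⟨hj, hr⟩), exchangeWeight]
    · exact fun r' hr'' hne => if_neg fun h =>
        hne (Finset.singleton_injective (((hiff j hjX r' hr'').1 h).2.symm.trans hr))
    · exact fun j' hj' hne => Finset.sum_eq_zero fun r' hr'' => if_neg fun h =>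
        hne (Finset.singleton_injective (((hiff j' hj' r' hr'').1 h).1.symm.trans hj))
  · refine (Finset.sum_eq_zero fun j hj => Finset.sum_eq_zero fun r hr => if_neg fun h => ?_).symm
    exact hcard ((card_inter_add_one_eq_iff X Y).2 ⟨j, r, (hiff j hj r hr).1 h⟩)

theorem matB_mulVec (α : Fin N → ℝ) (g : ArrVertex k N → ℂ) : (A.matB α).mulVec g X =
    ∑ m, ∑ r ∈ ((X.1.erase (idx X m))ᶜ).attach,
      (A.exchangeWeight α (X.1.erase (idx X m)) (idx X m) r : ℂ) *
        g (exchange X m r (Finset.mem_compl.1 r.2)) := by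
  have hentry : ∀ Y : ArrVertex k N, A.matB α X Y = ∑ m, ∑ r ∈ ((X.1.erase (idx X m))ᶜ).attach,
      if exchange X m r (Finset.mem_compl.1 r.2) = Y then
        (A.exchangeWeight α (X.1.erase (idx X m)) (idx X m) r : ℂ) else 0 := fun Y => by
    trans ∑ j ∈ X.1, ∑ r ∈ (X.1.erase j)ᶜ, if insert r (X.1.erase j) = Y.1 then
      (A.exchangeWeight α (X.1.erase j) j r : ℂ) else 0
    · rcases eq_or_ne X Y with rfl | hXY
      · exact A.matB_self X α
      · exact A.matB_apply_of_ne X α hXY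
    · rw [← sum_idx]
      refine Finset.sum_congr rfl fun m _ => ?_
      rw [← Finset.sum_attach]
      simp only [exchange, Subtype.ext_iff]
  simp only [Matrix.mulVec, dotProduct, hentry, Finset.sum_mul]
  rw [Finset.sum_comm]
  refine Finset.sum_congr rfl fun m _ => ?_
  rw [Finset.sum_comm]
  refine Finset.sum_congr rfl fun r _ => ?_
  simp only [ite_mul, zero_mul, Finset.sum_ite_eq, Finset.mem_univ, if_true]

end ResidueMatrix

section DifferentialEquation

variable {α : Fin N → ℝ} {lam ρ : ℂ}

theorem f0_eq_add_sum_div (x : Fin k → ℝ) :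
    A.f0 x = A.f0 (A.point X) + ∑ m, A.f (idx X m) x / A.slopeAt X m := by
  have hf : ∀ m, A.f (idx X m) x / A.slopeAt X m =
      A.f0 (A.edge X m) * A.coord X (x - A.point X) m := fun m => by
    rw [A.f_eq _ x (A.point X), A.point_spec X (idx_mem X m), zero_add, f0_edge_eq_one, one_mul,
      coord]
  rw [Finset.sum_congr rfl fun m _ => hf m, sum_map_edge_mul_coord, map_sub, add_sub_cancel]

/-- The coefficients of `f₀ - f₀(X')` with respect to the forms `f_j`, `j ∈ X'`, taken with their
signs on `Δ_X`. -/
def expansionCoeff (X' : ArrVertex k N) (m : Fin k) : ℝ :=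
  A.domainSign X (idx X' m) / A.slopeAt X' m

theorem f0_point_add_mul_sum (X' : ArrVertex k N) (ρ : ℂ) (a : Fin k → ℝ) :
    (A.f0 (A.point X) : ℂ) + ρ * ((∑ m, a m : ℝ) : ℂ) = A.f0 (A.point X') +
      ∑ m, (A.expansionCoeff X X' m : ℂ) * A.signedForm X ρ a (idx X' m) := by
  have hterm : ∀ m, (A.expansionCoeff X X' m : ℂ) * A.signedForm X ρ a (idx X' m) =
      ((A.f (idx X' m) (A.point X) / A.slopeAt X' m : ℝ) : ℂ) +
        ρ * ((A.f0 (A.edge X' m) * A.coord X' (A.param X a) m : ℝ) : ℂ) := fun m => by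
    have hsign : (A.domainSign X (idx X' m) : ℂ) * A.domainSign X (idx X' m) = 1 :=
      mod_cast A.domainSign_mul_self X (idx X' m)
    rw [← domainSign_mul_complexifyForm_rot_param, complexifyForm_rot_param, expansionCoeff,
      f0_edge_eq_one, coord, l]
    push_cast
    linear_combination (((A.f (idx X' m) (A.point X) : ℂ) +
      ρ * ((A.f (idx X' m)).linear (A.param X a) : ℂ)) / A.slopeAt X' m) * hsign
  rw [Finset.sum_congr rfl fun m _ => hterm m, Finset.sum_add_distrib, ← Finset.mul_sum,
    ← Complex.ofReal_sum, ← Complex.ofReal_sum, sum_map_edge_mul_coord, f0_param, ← add_assoc,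
    ← Complex.ofReal_add, ← f0_eq_add_sum_div]

theorem signedForm_mul_pullback_lower (α : Fin N → ℝ) {U : Finset (Fin N)} {j : Fin N}
    (hj : j ∈ U) (lam : ℂ) (hρ : ρ.im ≠ 0) {a : Fin k → ℝ} (ha : a ∈ posOrthant k) :
    A.signedForm X ρ a j * A.pullback X (lower α U) lam ρ a =
      A.pullback X (lower α (U.erase j)) lam ρ a := by
  rw [A.pullback_eq_signedForm_mul X (lower α (U.erase j)) lam (A.signedForm_ne_zero X hρ ha j),
    ← lower_insert α (Finset.notMem_erase j U), Finset.insert_erase hj]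

theorem hasDerivAt_coneIntegral {β : Fin N → ℝ} (hβ : ∀ m, -1 < β (idx X m))
    (hlam : 0 < (lam * ρ).re) (hρ : ρ.im ≠ 0) :
    HasDerivAt (fun lam => A.coneIntegral X β lam ρ)
      (∫ a in posOrthant k,
        -(ρ * ((∑ m, a m : ℝ) : ℂ)) * (ρ ^ k * A.pullback X β lam ρ a)) lam := by
  have hρ0 : ρ ≠ 0 := norm_pos_iff.1 (norm_pos_of_im_ne_zero hρ)
  have hderiv := (hasDerivAt_integral_laplaceCore (S := X.1ᶜ) (β := β)
    (b := A.signedSlope X) (γ := β ∘ idx X) (A.absAt_pos X) hβ (u := fun z => z * ρ)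
    (v := fun _ => ρ) (by fun_prop) (by fun_prop) hlam hρ).const_mul (A.coneFactor X β ρ)
  rw [funext fun z => A.coneIntegral_eq_coneFactor_mul X β z hρ0]
  refine hderiv.congr_deriv ?_
  rw [← integral_const_mul]
  refine setIntegral_congr_fun (measurableSet_posOrthant k) fun a ha => ?_
  have hpull : HasDerivAt (fun z => ρ ^ k * A.pullback X β z ρ a)
      (-(ρ * ((∑ m, a m : ℝ) : ℂ)) * (ρ ^ k * A.pullback X β lam ρ a)) lam := by
    have hexp := ((((hasDerivAt_id lam).mul_const ρ).fun_neg.mul_const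
      ((∑ m, a m : ℝ) : ℂ)).cexp.mul_const
        (∏ j, A.signedForm X ρ a j ^ (β j : ℂ))).const_mul (ρ ^ k)
    refine hexp.congr_deriv ?_
    rw [pullback, id]
    ring
  rw [← hpull.deriv, funext fun z => A.pow_mul_pullback X β z hρ0 ha, deriv_const_mul_field]
  rfl

theorem hasDerivAt_coneIntegral_lower (hα : ∀ j, 0 < α j) (X' : ArrVertex k N)
    (hlam : 0 < (lam * ρ).re) (hρ : ρ.im ≠ 0) :
    HasDerivAt (fun lam => A.coneIntegral X (lower α X'.1) lam ρ)
      ((A.f0 (A.point X) - A.f0 (A.point X')) * A.coneIntegral X (lower α X'.1) lam ρ -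
        ∑ m, (A.expansionCoeff X X' m : ℂ) *
          A.coneIntegral X (lower α (X'.1.erase (idx X' m))) lam ρ) lam := by
  refine (A.hasDerivAt_coneIntegral X (fun m => neg_one_lt_lower hα X'.1 _) hlam hρ).congr_deriv ?_
  have hint : ∀ U, IntegrableOn (fun a => ρ ^ k * A.pullback X (lower α U) lam ρ a)
      (posOrthant k) := fun U =>
    A.integrableOn_pow_mul_pullback X (fun m => neg_one_lt_lower hα U _) hlam hρ
  have hexpand : ∀ a ∈ posOrthant k,
      -(ρ * ((∑ m, a m : ℝ) : ℂ)) * (ρ ^ k * A.pullback X (lower α X'.1) lam ρ a) =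
      (A.f0 (A.point X) - A.f0 (A.point X')) * (ρ ^ k * A.pullback X (lower α X'.1) lam ρ a) -
        ∑ m, (A.expansionCoeff X X' m : ℂ) *
          (ρ ^ k * A.pullback X (lower α (X'.1.erase (idx X' m))) lam ρ a) := fun a ha => by
    have hf0 := A.f0_point_add_mul_sum X X' ρ a
    have hsum : ∑ m, (A.expansionCoeff X X' m : ℂ) *
        (ρ ^ k * A.pullback X (lower α (X'.1.erase (idx X' m))) lam ρ a) =
        (∑ m, (A.expansionCoeff X X' m : ℂ) * A.signedForm X ρ a (idx X' m)) *
          (ρ ^ k * A.pullback X (lower α X'.1) lam ρ a) := by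
      rw [Finset.sum_mul]
      refine Finset.sum_congr rfl fun m _ => ?_
      rw [← A.signedForm_mul_pullback_lower X α (idx_mem X' m) lam hρ ha]
      ring
    rw [hsum]
    linear_combination -(ρ ^ k * A.pullback X (lower α X'.1) lam ρ a) * hf0
  rw [setIntegral_congr_fun (measurableSet_posOrthant k) hexpand,
    integral_sub ((hint _).const_mul _) (integrable_finsetSum _ fun m _ => (hint _).const_mul _),
    integral_finsetSum _ fun m _ => (hint _).const_mul _]
  simp only [integral_const_mul, coneIntegral]

theorem signOn_insert {U : Finset (Fin N)} {r : Fin N} (hr : r ∉ U) :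
    A.signOn X (insert r U) = A.domainSign X r * A.signOn X U :=
  Finset.prod_insert hr

theorem signOn_mul_absDet_exchange (X' : ArrVertex k N) (m : Fin k) {r : Fin N}
    (hr : r ∉ X'.1.erase (idx X' m)) :
    A.expansionCoeff X X' m * (A.domainSign X r * A.l r (A.edge X' m)) *
        (A.signOn X X'.1 * A.absDet X') =
      Real.sign (A.slopeAt X' m * A.l r (A.edge X' m)) *
        (A.signOn X (exchange X' m r hr).1 * A.absDet (exchange X' m r hr)) := by
  have hdet : A.absDet (exchange X' m r hr) =
      A.absDet X' * (|A.l r (A.edge X' m)| / |A.slopeAt X' m|) := by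
    rw [← mul_div_assoc, ← absDet_exchange A X' m hr,
      mul_div_cancel_right₀ _ (abs_ne_zero.2 (A.slopeAt_ne_zero X' m))]
  have hsign : A.signOn X X'.1 =
      A.domainSign X (idx X' m) * A.signOn X (X'.1.erase (idx X' m)) := by
    rw [← signOn_insert _ _ (Finset.notMem_erase _ _), Finset.insert_erase (idx_mem X' m)]
  have hsign' : A.signOn X (exchange X' m r hr).1 =
      A.domainSign X r * A.signOn X (X'.1.erase (idx X' m)) := A.signOn_insert X hr
  have hself := A.domainSign_mul_self X (idx X' m)
  have hratio := sign_mul_abs_div_abs (A.slopeAt X' m) (A.l r (A.edge X' m))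
  rw [hdet, hsign, hsign', expansionCoeff]
  calc _ = A.absDet X' * A.signOn X (X'.1.erase (idx X' m)) * A.domainSign X r *
        (A.domainSign X (idx X' m) * A.domainSign X (idx X' m)) *
        (A.l r (A.edge X' m) / A.slopeAt X' m) := by ring
    _ = _ := by rw [hself, ← hratio]; ring

theorem matB_mulVec_rhoIntegral (hα : ∀ j, 0 < α j) (X' : ArrVertex k N)
    (hlam : 0 < (lam * ρ).re) (hρ : ρ.im ≠ 0) :
    (A.matB α).mulVec (A.rhoIntegral α ρ X · lam) X' =
      lam * (A.coneVolume X * (A.prefactor X X' lam * ∑ m, (A.expansionCoeff X X' m : ℂ) *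
        A.coneIntegral X (lower α (X'.1.erase (idx X' m))) lam ρ)) := by
  rw [matB_mulVec]
  simp only [Finset.mul_sum]
  refine Finset.sum_congr rfl fun m _ => ?_
  have hparts := A.mul_coneIntegral_lower_eq_sum_compl X hα (card_erase_idx X' m) hlam hρ
  rw [← Finset.sum_attach] at hparts
  trans (A.coneVolume X * A.prefactor X X' lam * A.expansionCoeff X X' m) *
    (lam * A.coneIntegral X (lower α (X'.1.erase (idx X' m))) lam ρ)
  · rw [hparts, Finset.mul_sum]
    refine Finset.sum_congr rfl fun r _ => ?_
    have hcoeff := congrArg (Complex.ofReal)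
      (A.signOn_mul_absDet_exchange X X' m (Finset.mem_compl.1 r.2))
    rw [A.rhoIntegral_eq_prefactor_mul X α hρ, prefactor, prefactor, exchangeWeight]
    simp only [exchange, edge, slopeAt] at hcoeff ⊢
    push_cast at hcoeff ⊢
    linear_combination -(α r * A.coneVolume X * Complex.exp (-lam * A.f0 (A.point X)) *
      A.coneIntegral X (lower α (insert r.1 (X'.1.erase (idx X' m)))) lam ρ : ℂ) * hcoeff
  · ring

theorem hasDerivAt_rhoIntegral (hα : ∀ j, 0 < α j) (X' : ArrVertex k N)
    (hlam : 0 < (lam * ρ).re) (hρ : ρ.im ≠ 0) :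
    HasDerivAt (fun lam => A.rhoIntegral α ρ X X' lam)
      ((-((A.matA + lam⁻¹ • A.matB α).mulVec (A.rhoIntegral α ρ X · lam))) X') lam := by
  have hlam0 : lam ≠ 0 := by
    rintro rfl
    simp at hlam
  have hprefactor : HasDerivAt (fun lam => A.prefactor X X' lam)
      (-(A.f0 (A.point X) : ℂ) * A.prefactor X X' lam) lam := by
    refine (((hasDerivAt_neg lam).mul_const (A.f0 (A.point X) : ℂ)).cexp.const_mul
      ((A.signOn X X'.1 * A.absDet X' : ℝ) : ℂ)).congr_deriv ?_
    rw [prefactor]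
    ring
  rw [funext fun lam => A.rhoIntegral_eq_prefactor_mul X α hρ X' lam]
  refine ((hprefactor.mul (A.hasDerivAt_coneIntegral_lower X hα X' hlam hρ)).const_mul
    (A.coneVolume X : ℂ)).congr_deriv ?_
  rw [Pi.neg_apply, Matrix.add_mulVec, Matrix.smul_mulVec, Pi.add_apply, Pi.smul_apply, smul_eq_mul,
    A.matB_mulVec_rhoIntegral X hα X' hlam hρ, inv_mul_cancel_left₀ hlam0, matA,
    Matrix.mulVec_diagonal, A.rhoIntegral_eq_prefactor_mul X α hρ X' lam]
  ring

end DifferentialEquation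

end GenericArrangement

section SectorDirection

/-- Half of the argument of `-σ i λ`, which measures `λ` from the bisector of `slitDomain σ`. -/
def halfAngle (σ : ℝ) (lam : ℂ) : ℝ := Complex.arg (-(σ * Complex.I * lam)) / 2

/-- The direction `ρ` of modulus `|λ|⁻¹` halfway between the bisector of the admissible half-plane
and `λ⁻¹`: it stays admissible as long as `λ` stays in `slitDomain σ`. -/
def sectorDirection (σ : ℝ) (lam : ℂ) : ℂ :=
  Complex.exp (-sectorLog σ lam + halfAngle σ lam * Complex.I)

variable {σ : ℝ} {lam : ℂ}

theorem sectorDirection_ne_zero (σ : ℝ) (lam : ℂ) : sectorDirection σ lam ≠ 0 :=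
  Complex.exp_ne_zero _

theorem abs_halfAngle_le (σ : ℝ) (lam : ℂ) : |halfAngle σ lam| ≤ Real.pi / 2 := by
  rw [halfAngle, abs_div, abs_two]
  exact div_le_div_of_nonneg_right (Complex.abs_arg_le_pi _) two_pos.le

theorem abs_halfAngle_lt (hcos : 0 < Real.cos (halfAngle σ lam)) :
    |halfAngle σ lam| < Real.pi / 2 := by
  refine (abs_halfAngle_le σ lam).lt_of_ne fun h => ?_
  rw [← Real.cos_abs, h, Real.cos_pi_div_two] at hcos
  exact hcos.false

theorem cos_halfAngle_pos (hσ : σ = 1 ∨ σ = -1) (hlam : lam ∈ slitDomain σ) :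
    0 < Real.cos (halfAngle σ lam) := by
  have hslit : -(σ * Complex.I * lam) ∈ Complex.slitPlane := by
    simp only [slitDomain, Set.mem_ofPred_eq, not_and_or, not_le] at hlam
    have hre : (-(σ * Complex.I * lam)).re = σ * lam.im := by simp
    have him : (-(σ * Complex.I * lam)).im = -(σ * lam.re) := by simp
    rw [Complex.mem_slitPlane_iff, hre, him]
    refine hlam.symm.imp_right fun h => neg_ne_zero.2 (mul_ne_zero ?_ h)
    rcases hσ with rfl | rfl <;> norm_num
  have hlt := Complex.neg_pi_lt_arg (-(σ * Complex.I * lam))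
  have hlt' := (Complex.arg_le_pi _).lt_of_ne (Complex.mem_slitPlane_iff_arg.1 hslit).1
  exact Real.cos_pos_of_mem_Ioo ⟨by rw [halfAngle]; linarith, by rw [halfAngle]; linarith⟩

theorem arg_neg_mul_I_mul_exp (hσ : σ = 1 ∨ σ = -1) {r θ : ℝ} (hr : 0 < r)
    (hθ : -(Real.pi / 2) < σ * θ) (hθ' : σ * θ < 3 * Real.pi / 2) :
    Complex.arg (-(σ * Complex.I * (r * Complex.exp (θ * Complex.I)))) =
      θ - σ * (Real.pi / 2) := by
  have hexp : Complex.exp ((-(σ * (Real.pi / 2)) : ℝ) * Complex.I) = -(σ * Complex.I) := by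
    rw [Complex.exp_mul_I, ← Complex.ofReal_cos, ← Complex.ofReal_sin]
    rcases hσ with rfl | rfl <;> simp
  have harg : -(σ * Complex.I * (r * Complex.exp (θ * Complex.I))) =
      r * Complex.exp (((θ - σ * (Real.pi / 2) : ℝ) : ℂ) * Complex.I) := by
    rw [sub_eq_add_neg, Complex.ofReal_add, add_mul, Complex.exp_add, hexp]
    ring
  rw [harg, Complex.arg_real_mul _ hr, Complex.arg_exp_mul_I, toIocMod_eq_self]
  constructor <;> rcases hσ with rfl | rfl <;> linarith

theorem ne_zero_of_mem_stokesSector {ε : ℝ} (hlam : lam ∈ stokesSector σ ε) : lam ≠ 0 := by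
  obtain ⟨r, θ, hr, -, -, rfl⟩ := hlam
  exact mul_ne_zero (Complex.ofReal_ne_zero.2 hr.ne') (Complex.exp_ne_zero _)

theorem sin_le_cos_halfAngle (hσ : σ = 1 ∨ σ = -1) {ε : ℝ} (hε : 0 < ε)
    (hlam : lam ∈ stokesSector σ ε) : Real.sin (ε / 2) ≤ Real.cos (halfAngle σ lam) := by
  obtain ⟨r, θ, hr, hθ, hθ', rfl⟩ := hlam
  have habs : |halfAngle σ (r * Complex.exp (θ * Complex.I))| ≤ Real.pi / 2 - ε / 2 := by
    rw [halfAngle, arg_neg_mul_I_mul_exp hσ hr (by linarith) (by linarith), abs_le]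
    constructor <;> rcases hσ with rfl | rfl <;> linarith
  rw [← Real.cos_abs (halfAngle _ _), ← Real.cos_pi_div_two_sub]
  exact Real.cos_le_cos_of_nonneg_of_le_pi (abs_nonneg _) (by linarith [Real.pi_pos]) habs

theorem sectorLog_re (hσ : σ = 1 ∨ σ = -1) (lam : ℂ) :
    (sectorLog σ lam).re = Real.log ‖lam‖ := by
  have hnorm : ‖-(σ * Complex.I * lam)‖ = ‖lam‖ := by rcases hσ with rfl | rfl <;> simp
  rw [sectorLog, Complex.add_re, Complex.log_re, hnorm]
  simp

theorem sectorLog_im (σ : ℝ) (lam : ℂ) :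
    (sectorLog σ lam).im = 2 * halfAngle σ lam + σ * (Real.pi / 2) := by
  rw [sectorLog, Complex.add_im, Complex.log_im, halfAngle]
  simp [mul_div_cancel₀]

theorem exp_sectorLog (hσ : σ = 1 ∨ σ = -1) (hlam : lam ≠ 0) :
    Complex.exp (sectorLog σ lam) = lam := by
  have hexp : Complex.exp (σ * (Real.pi / 2) * Complex.I) = σ * Complex.I := by
    rcases hσ with rfl | rfl <;> simp [neg_mul, Complex.exp_neg, Complex.exp_pi_div_two_mul_I]
  have hσ0 : -(σ * Complex.I * lam) ≠ 0 := by rcases hσ with rfl | rfl <;> simp [hlam]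
  rw [sectorLog, Complex.exp_add, Complex.exp_log hσ0, hexp]
  rcases hσ with rfl | rfl <;> push_cast <;> linear_combination (-lam) * Complex.I_mul_I

theorem sectorPow_add (σ : ℝ) (lam s t : ℂ) :
    sectorPow σ lam (s + t) = sectorPow σ lam s * sectorPow σ lam t := by
  rw [sectorPow, add_mul, Complex.exp_add, sectorPow, sectorPow]

theorem sectorPow_neg_natCast (hσ : σ = 1 ∨ σ = -1) (hlam : lam ≠ 0) (d : ℕ) :
    sectorPow σ lam (-(d : ℂ)) = (lam ^ d)⁻¹ := by
  rw [sectorPow, neg_mul, Complex.exp_neg, Complex.exp_nat_mul, exp_sectorLog hσ hlam]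

theorem mul_sectorDirection (hσ : σ = 1 ∨ σ = -1) (hlam : lam ≠ 0) :
    lam * sectorDirection σ lam = Complex.exp (halfAngle σ lam * Complex.I) := by
  rw [sectorDirection, Complex.exp_add, Complex.exp_neg, exp_sectorLog hσ hlam,
    mul_inv_cancel_left₀ hlam]

theorem mul_sectorDirection_re (hσ : σ = 1 ∨ σ = -1) (hlam : lam ≠ 0) :
    (lam * sectorDirection σ lam).re = Real.cos (halfAngle σ lam) := by
  rw [mul_sectorDirection hσ hlam, Complex.exp_ofReal_mul_I_re]

theorem norm_sectorDirection (hσ : σ = 1 ∨ σ = -1) (hlam : lam ≠ 0) :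
    ‖sectorDirection σ lam‖ = ‖lam‖⁻¹ := by
  rw [sectorDirection, Complex.norm_exp, Complex.add_re, Complex.neg_re, sectorLog_re hσ,
    Complex.re_ofReal_mul, Complex.I_re, mul_zero, add_zero, Real.exp_neg,
    Real.exp_log (norm_pos_iff.2 hlam)]

theorem sectorDirection_im (hσ : σ = 1 ∨ σ = -1) (hlam : lam ≠ 0) :
    (sectorDirection σ lam).im = -(σ * (‖lam‖⁻¹ * Real.cos (halfAngle σ lam))) := by
  have him : (-sectorLog σ lam + halfAngle σ lam * Complex.I).im =
      -(halfAngle σ lam + σ * (Real.pi / 2)) := by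
    simp only [Complex.add_im, Complex.neg_im, sectorLog_im, Complex.im_ofReal_mul, Complex.I_im]
    ring
  have hsin : Real.sin (halfAngle σ lam + σ * (Real.pi / 2)) =
      σ * Real.cos (halfAngle σ lam) := by
    rcases hσ with rfl | rfl
    · simp [Real.sin_add_pi_div_two]
    · simp [← sub_eq_add_neg, Real.sin_sub_pi_div_two]
  rw [sectorDirection, Complex.exp_im, ← Complex.norm_exp, ← sectorDirection,
    norm_sectorDirection hσ hlam, him, Real.sin_neg, hsin]
  ring

theorem log_sectorDirection (hσ : σ = 1 ∨ σ = -1) (hcos : 0 < Real.cos (halfAngle σ lam)) :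
    Complex.log (sectorDirection σ lam) = -sectorLog σ lam + halfAngle σ lam * Complex.I := by
  have hangle := abs_lt.1 (abs_halfAngle_lt hcos)
  have him : (-sectorLog σ lam + halfAngle σ lam * Complex.I).im =
      -(halfAngle σ lam + σ * (Real.pi / 2)) := by
    simp only [Complex.add_im, Complex.neg_im, sectorLog_im, Complex.im_ofReal_mul, Complex.I_im]
    ring
  rw [sectorDirection]
  apply Complex.log_exp <;> rw [him] <;> rcases hσ with rfl | rfl <;> linarith

theorem sectorDirection_cpow (hσ : σ = 1 ∨ σ = -1) (hcos : 0 < Real.cos (halfAngle σ lam))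
    (s : ℂ) : sectorDirection σ lam ^ s =
      sectorPow σ lam (-s) * Complex.exp (s * (halfAngle σ lam * Complex.I)) := by
  rw [Complex.cpow_def_of_ne_zero (sectorDirection_ne_zero σ lam), log_sectorDirection hσ hcos,
    sectorPow, ← Complex.exp_add]
  ring_nf

theorem sectorDirection_mem_imSector (hσ : σ = 1 ∨ σ = -1) (hlam : lam ≠ 0) {δ : ℝ} (hδ : 0 < δ)
    (hcos : δ ≤ Real.cos (halfAngle σ lam)) : sectorDirection σ lam ∈ imSector δ := by
  have hinv : 0 < ‖lam‖⁻¹ := inv_pos.2 (norm_pos_iff.2 hlam)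
  have him : |(sectorDirection σ lam).im| = ‖lam‖⁻¹ * Real.cos (halfAngle σ lam) := by
    have hσ1 : |σ| = 1 := by rcases hσ with rfl | rfl <;> simp
    rw [sectorDirection_im hσ hlam, abs_neg, abs_mul, hσ1, one_mul,
      abs_of_pos (mul_pos hinv (hδ.trans_le hcos))]
  refine ⟨abs_pos.1 (him ▸ mul_pos hinv (hδ.trans_le hcos)), ?_⟩
  rw [him, norm_sectorDirection hσ hlam, mul_comm]
  exact mul_le_mul_of_nonneg_left hcos hinv.le

theorem GenericArrangement.sectorDirection_mem_wedge (hσ : σ = 1 ∨ σ = -1) (hlam : lam ≠ 0)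
    (hcos : 0 < Real.cos (halfAngle σ lam)) : sectorDirection σ lam ∈ wedge σ lam := by
  refine ⟨?_, (mul_sectorDirection_re hσ hlam).symm ▸ hcos⟩
  have hinv : 0 < ‖lam‖⁻¹ * Real.cos (halfAngle σ lam) :=
    mul_pos (inv_pos.2 (norm_pos_iff.2 hlam)) hcos
  rw [sectorDirection_im hσ hlam]
  rcases hσ with rfl | rfl <;> linarith

theorem eventually_sin_le_cos_halfAngle (hσ : σ = 1 ∨ σ = -1) {ε : ℝ} (hε : 0 < ε) :
    ∀ᶠ lam in Bornology.cobounded ℂ ⊓ 𝓟 (stokesSector σ ε),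
      lam ≠ 0 ∧ Real.sin (ε / 2) ≤ Real.cos (halfAngle σ lam) :=
  eventually_inf_principal.2 <| .of_forall fun _ hlam =>
    ⟨ne_zero_of_mem_stokesSector hlam, sin_le_cos_halfAngle hσ hε hlam⟩

theorem tendsto_sectorDirection (hσ : σ = 1 ∨ σ = -1) :
    Tendsto (sectorDirection σ) (Bornology.cobounded ℂ) (𝓝 0) :=
  tendsto_zero_iff_norm_tendsto_zero.2 <|
    (tendsto_inv_atTop_zero.comp tendsto_norm_cobounded_atTop).congr' <|
      (Bornology.eventually_ne_cobounded 0).mono fun _ h => (norm_sectorDirection hσ h).symm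

end SectorDirection

theorem exp_mul_integral_gammaDensity {k : ℕ} {γ : Fin k → ℝ} (hγ : ∀ m, -1 < γ m) {θ : ℝ}
    (hθ : |θ| < Real.pi / 2) :
    Complex.exp (((∑ m, (γ m + 1) : ℝ) : ℂ) * (θ * Complex.I)) *
      ∫ a in posOrthant k, gammaDensity γ (Complex.exp (θ * Complex.I)) a =
      ((∏ m, Real.Gamma (γ m + 1) : ℝ) : ℂ) := by
  have hangle := abs_lt.1 hθ
  have hlog : Complex.log (Complex.exp (θ * Complex.I)) = θ * Complex.I :=
    Complex.log_exp (by simp; linarith) (by simp; linarith)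
  have hre : 0 < (Complex.exp (θ * Complex.I)).re := by
    rw [Complex.exp_ofReal_mul_I_re]
    exact Real.cos_pos_of_mem_Ioo hangle
  rw [integral_gammaDensity hγ hre, Complex.ofReal_sum, Finset.sum_mul, Complex.exp_sum,
    ← Finset.prod_mul_distrib, Complex.ofReal_prod]
  refine Finset.prod_congr rfl fun m _ => ?_
  rw [Complex.cpow_def_of_ne_zero (Complex.exp_ne_zero _), hlog, mul_left_comm, ← Complex.exp_add]
  convert mul_one _
  rw [← Complex.exp_zero]
  ring_nf

namespace GenericArrangement

variable {k N : ℕ} (A : GenericArrangement k N) (X : ArrVertex k N)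

section Asymptotics

variable {α β : Fin N → ℝ} {σ : ℝ} {lam : ℂ}

theorem hasDerivAt_solution (hα : ∀ j, 0 < α j) (hσ : σ = 1 ∨ σ = -1) (hlam : lam ∈ slitDomain σ) :
    HasDerivAt (fun μ => A.solution α σ X μ)
      (-((A.matA + lam⁻¹ • A.matB α).mulVec (A.solution α σ X lam))) lam := by
  have hlam0 : lam ≠ 0 := by
    rintro rfl
    simp [slitDomain] at hlam
  set ρ := sectorDirection σ lam
  have hρ : ρ ∈ wedge σ lam := sectorDirection_mem_wedge hσ hlam0 (cos_halfAngle_pos hσ hlam)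
  have hnear : ∀ᶠ μ in 𝓝 lam, ρ ∈ wedge σ μ :=
    ((Complex.continuous_re.comp (continuous_mul_const ρ)).continuousAt.eventually_const_lt
      hρ.2).mono fun μ hμ => ⟨hρ.1, hμ⟩
  have hsol : A.solution α σ X lam = (A.rhoIntegral α ρ X · lam) :=
    funext fun X' => A.solution_eq_rhoIntegral X hα X' hρ
  rw [hasDerivAt_pi, hsol]
  exact fun X' => (A.hasDerivAt_rhoIntegral X hα X' hρ.2
    (im_ne_zero_of_mem_wedge hρ)).congr_of_eventuallyEq
      (hnear.mono fun μ hμ => A.solution_eq_rhoIntegral X hα X' hμ)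

theorem coneFactor_sectorDirection (β : Fin N → ℝ) (hσ : σ = 1 ∨ σ = -1)
    (hcos : 0 < Real.cos (halfAngle σ lam)) :
    A.coneFactor X β (sectorDirection σ lam) =
      ((∏ m, |A.slopeAt X m| ^ β (idx X m) : ℝ) : ℂ) *
        (sectorPow σ lam (-((∑ m, (β (idx X m) + 1) : ℝ) : ℂ)) *
          Complex.exp (((∑ m, (β (idx X m) + 1) : ℝ) : ℂ) * (halfAngle σ lam * Complex.I))) := by
  rw [← sectorDirection_cpow hσ hcos, coneFactor, Finset.prod_mul_distrib, Complex.ofReal_prod,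
    Complex.ofReal_sum]
  simp only [Complex.cpow_def_of_ne_zero (sectorDirection_ne_zero σ lam)]
  rw [Finset.mul_sum, Complex.exp_sum]

theorem tendsto_exp_mul_integral_core (hβ : ∀ m, -1 < β (idx X m)) (hσ : σ = 1 ∨ σ = -1) {ε : ℝ}
    (hε : 0 < ε) (hε' : ε < 2 * Real.pi) :
    Tendsto (fun lam => Complex.exp (((∑ m, (β (idx X m) + 1) : ℝ) : ℂ) *
        (halfAngle σ lam * Complex.I)) * ∫ a in posOrthant k,
          A.core X β (lam * sectorDirection σ lam) (sectorDirection σ lam) a)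
      (Bornology.cobounded ℂ ⊓ 𝓟 (stokesSector σ ε))
      (𝓝 (((∏ j ∈ X.1ᶜ, A.absAt X j ^ β j) * ∏ m, Real.Gamma (β (idx X m) + 1) : ℝ) : ℂ)) := by
  have hcg : (Bornology.cobounded ℂ).IsCountablyGenerated := by
    rw [← comap_norm_atTop]
    infer_instance
  have hsin : 0 < Real.sin (ε / 2) := Real.sin_pos_of_pos_of_lt_pi (by linarith) (by linarith)
  have hS := eventually_sin_le_cos_halfAngle hσ hε
  have hcore := tendsto_integral_laplaceCore_sub (b := A.signedSlope X) (γ := β ∘ idx X) (β := β)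
    (A.absAt_pos X) hβ hsin hsin
    (hS.mono fun lam h => h.2.trans_eq (mul_sectorDirection_re hσ h.1).symm)
    (hS.mono fun lam h => sectorDirection_mem_imSector hσ h.1 hsin h.2)
    ((tendsto_sectorDirection hσ).mono_left inf_le_left)
  refine tendsto_sub_nhds_zero_iff.1 (tendsto_zero_iff_norm_tendsto_zero.2 ?_)
  refine (tendsto_zero_iff_norm_tendsto_zero.1 hcore).congr' (hS.mono fun lam h => ?_)
  set phase := Complex.exp (((∑ m, (β (idx X m) + 1) : ℝ) : ℂ) *
    (halfAngle σ lam * Complex.I)) with hphase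
  have hphase_norm : ‖phase‖ = 1 := by
    rw [hphase, ← mul_assoc, ← Complex.ofReal_mul, Complex.norm_exp_ofReal_mul_I]
  have hgamma : phase * _ = _ :=
    exp_mul_integral_gammaDensity hβ (abs_halfAngle_lt (hsin.trans_le h.2))
  rw [← mul_sectorDirection hσ h.1] at hgamma
  change _ = ‖phase * _ - _‖
  rw [Complex.ofReal_mul, ← hgamma, mul_left_comm, ← mul_sub, norm_mul, hphase_norm, one_mul]
  rfl

theorem sum_lower_add_one (α : Fin N → ℝ) (X' : ArrVertex k N) :
    ∑ m, (lower α X'.1 (idx X m) + 1) = weight α X.1 + (X.1 \ X'.1).card := by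
  rw [sum_idx X fun j => lower α X'.1 j + 1, weight, Finset.card_eq_sum_ones, Nat.cast_sum,
    Finset.sdiff_eq_filter, Finset.sum_filter, ← Finset.sum_add_distrib]
  refine Finset.sum_congr rfl fun j _ => ?_
  rw [lower]
  split_ifs <;> simp_all

/-- The constant factor that the linear coordinates on the cone at `X` split off the integral of
`Ω_{X'}`. -/
def leadingFactor (α : Fin N → ℝ) (X' : ArrVertex k N) : ℝ :=
  A.coneVolume X * (A.signOn X X'.1 * A.absDet X') *
    ∏ m, |A.slopeAt X m| ^ lower α X'.1 (idx X m)

/-- The solution divided by `e^{-λ f₀(X)} λ^{-α_X}`, on the contour in `sectorDirection`. -/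
def normalizedSolution (α : Fin N → ℝ) (σ : ℝ) (lam : ℂ) (X' : ArrVertex k N) : ℂ :=
  A.leadingFactor X α X' * (lam ^ (X.1 \ X'.1).card)⁻¹ *
    (Complex.exp (((∑ m, (lower α X'.1 (idx X m) + 1) : ℝ) : ℂ) *
      (halfAngle σ lam * Complex.I)) * ∫ a in posOrthant k,
        A.core X (lower α X'.1) (lam * sectorDirection σ lam) (sectorDirection σ lam) a)

theorem solution_eq_smul_normalizedSolution (hα : ∀ j, 0 < α j) (hσ : σ = 1 ∨ σ = -1)
    (hlam : lam ≠ 0) (hcos : 0 < Real.cos (halfAngle σ lam)) :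
    A.solution α σ X lam = (Complex.exp (-lam * (A.f0 (A.point X) : ℂ)) *
      sectorPow σ lam (-(weight α X.1 : ℂ))) • A.normalizedSolution X α σ lam := by
  funext X'
  have hρ : sectorDirection σ lam ∈ wedge σ lam := sectorDirection_mem_wedge hσ hlam hcos
  have hpow : sectorPow σ lam (-((∑ m, (lower α X'.1 (idx X m) + 1) : ℝ) : ℂ)) =
      sectorPow σ lam (-(weight α X.1 : ℂ)) * (lam ^ (X.1 \ X'.1).card)⁻¹ := by
    rw [sum_lower_add_one, ← sectorPow_neg_natCast hσ hlam, ← sectorPow_add, Complex.ofReal_add,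
      Complex.ofReal_natCast, neg_add]
  rw [A.solution_eq_rhoIntegral X hα X' hρ,
    A.rhoIntegral_eq_prefactor_mul X α (im_ne_zero_of_mem_wedge hρ),
    A.coneIntegral_eq_coneFactor_mul X _ lam (sectorDirection_ne_zero σ lam),
    A.coneFactor_sectorDirection X _ hσ hcos, hpow, Pi.smul_apply, smul_eq_mul, prefactor,
    normalizedSolution, leadingFactor, Complex.ofReal_mul (_ * _),
    Complex.ofReal_mul (A.coneVolume X)]
  ring

theorem coneSign_eq_signOn : A.coneSign X = A.signOn X X.1 :=
  Finset.prod_congr rfl fun j hj => by rw [domainSign, if_pos hj]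

theorem coneSign_ne_zero : A.coneSign X ≠ 0 := by
  have h := A.signOn_mul_self X X.1
  rw [← coneSign_eq_signOn] at h
  exact left_ne_zero_of_mul_eq_one h

theorem constD_pos (hα : ∀ j, 0 < α j) : 0 < A.constD α X :=
  mul_pos (mul_pos (Finset.prod_pos fun j _ => Real.Gamma_pos_of_pos (hα j))
    (Finset.prod_pos fun _ hj => Real.rpow_pos_of_pos (abs_pos.2 (A.l_edge_ne X hj)) _))
    (Finset.prod_pos fun j hj => Real.rpow_pos_of_pos (A.absAt_pos X j hj) _)

theorem leadingFactor_self (α : Fin N → ℝ) :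
    A.leadingFactor X α X = A.coneSign X * ∏ j ∈ X.1, |A.l j (A.edgeVec (X.1.erase j))| ^ α j := by
  have hslope : (∏ m, |A.slopeAt X m|) * ∏ m, |A.slopeAt X m| ^ lower α X.1 (idx X m) =
      ∏ j ∈ X.1, |A.l j (A.edgeVec (X.1.erase j))| ^ α j := by
    rw [← Finset.prod_mul_distrib, ← prod_idx X]
    refine Finset.prod_congr rfl fun m _ => ?_
    have hpos := abs_pos.2 (A.slopeAt_ne_zero X m)
    rw [lower, if_pos (idx_mem X m), Real.rpow_sub_one hpos.ne', mul_div_cancel₀ _ hpos.ne']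
    rfl
  rw [leadingFactor, coneSign_eq_signOn, ← hslope, ← A.absDet_mul_coneVolume X]
  ring

theorem leadingFactor_self_mul (α : Fin N → ℝ) :
    A.leadingFactor X α X * ((∏ j ∈ X.1ᶜ, A.absAt X j ^ lower α X.1 j) *
      ∏ m, Real.Gamma (lower α X.1 (idx X m) + 1)) = A.coneSign X * A.constD α X := by
  have hGamma : ∏ m, Real.Gamma (lower α X.1 (idx X m) + 1) = ∏ j ∈ X.1, Real.Gamma (α j) := by
    rw [← prod_idx X]
    exact Finset.prod_congr rfl fun m _ => by rw [lower, if_pos (idx_mem X m), sub_add_cancel]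
  have habs : ∏ j ∈ X.1ᶜ, A.absAt X j ^ lower α X.1 j = ∏ j ∈ X.1ᶜ, |A.f j (A.point X)| ^ α j :=
    Finset.prod_congr rfl fun j hj => by rw [lower, if_neg (Finset.mem_compl.1 hj), absAt]
  rw [leadingFactor_self, hGamma, habs, constD]
  ring

theorem card_sdiff_ne_zero {X X' : ArrVertex k N} (h : X' ≠ X) : (X.1 \ X'.1).card ≠ 0 := fun h0 =>
  h (Subtype.ext (Finset.eq_of_subset_of_card_le
    (Finset.sdiff_eq_empty_iff_subset.1 (Finset.card_eq_zero.1 h0)) (by rw [X.2, X'.2])).symm)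

theorem tendsto_normalizedSolution (hα : ∀ j, 0 < α j) (hσ : σ = 1 ∨ σ = -1) {ε : ℝ} (hε : 0 < ε)
    (hε' : ε < 2 * Real.pi) :
    Tendsto (A.normalizedSolution X α σ) (Bornology.cobounded ℂ ⊓ 𝓟 (stokesSector σ ε))
      (𝓝 (((A.coneSign X * A.constD α X : ℝ) : ℂ) • Pi.single X 1)) := by
  refine tendsto_pi_nhds.2 fun X' => ?_
  have hcore := A.tendsto_exp_mul_integral_core X (β := lower α X'.1)
    (fun _ => neg_one_lt_lower hα _ _) hσ hε hε'
  by_cases hX : X' = X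
  · subst hX
    rw [Pi.smul_apply, Pi.single_eq_same, smul_eq_mul, mul_one, ← leadingFactor_self_mul,
      Complex.ofReal_mul]
    refine (hcore.const_mul _).congr fun lam => ?_
    rw [normalizedSolution, Finset.sdiff_self, Finset.card_empty, pow_zero, inv_one, mul_one]
  · have hpow : Tendsto (fun lam : ℂ => (lam ^ (X.1 \ X'.1).card)⁻¹)
        (Bornology.cobounded ℂ ⊓ 𝓟 (stokesSector σ ε)) (𝓝 0) :=
      (tendsto_inv₀_cobounded.comp
        (tendsto_pow_cobounded_cobounded (card_sdiff_ne_zero hX))).mono_left inf_le_left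
    rw [Pi.smul_apply, Pi.single_eq_of_ne hX, smul_zero]
    simpa only [mul_zero, zero_mul, normalizedSolution] using
      (hpow.const_mul (A.leadingFactor X α X' : ℂ)).mul hcore

theorem isEquivalent_solution (hα : ∀ j, 0 < α j) (hσ : σ = 1 ∨ σ = -1) {ε : ℝ} (hε : 0 < ε)
    (hε' : ε < 2 * Real.pi) :
    (fun lam => A.solution α σ X lam)
      ~[Bornology.cobounded ℂ ⊓ 𝓟 (stokesSector σ ε)]
      fun lam => (((A.coneSign X * A.constD α X : ℝ) : ℂ) *
        Complex.exp (-lam * (A.f0 (A.point X) : ℂ)) *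
        sectorPow σ lam (-(weight α X.1 : ℂ))) • (Pi.single X 1 : ArrVertex k N → ℂ) := by
  have hsin : 0 < Real.sin (ε / 2) := Real.sin_pos_of_pos_of_lt_pi (by linarith) (by linarith)
  have hne : ((A.coneSign X * A.constD α X : ℝ) : ℂ) • (Pi.single X 1 : ArrVertex k N → ℂ) ≠ 0 :=
    smul_ne_zero (Complex.ofReal_ne_zero.2
      (mul_ne_zero (A.coneSign_ne_zero X) (A.constD_pos X hα).ne'))
      (Pi.single_ne_zero_iff.2 one_ne_zero)
  have hequiv := (IsEquivalent.refl (u := fun lam => Complex.exp (-lam * (A.f0 (A.point X) : ℂ)) *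
    sectorPow σ lam (-(weight α X.1 : ℂ)))).smul ((isEquivalent_const_iff_tendsto hne).2
      (A.tendsto_normalizedSolution X hα hσ hε hε'))
  refine (hequiv.congr_left ?_).congr_right (.of_forall fun lam => ?_)
  · exact (eventually_sin_le_cos_halfAngle hσ hε).mono fun lam h =>
      (A.solution_eq_smul_normalizedSolution X hα hσ h.1 (hsin.trans_le h.2)).symm
  · simp only [Function.const_apply, smul_smul, mul_comm, mul_left_comm]

end Asymptotics

end GenericArrangement

end

theorem proposition2 {k N : ℕ} (A : GenericArrangement k N)
    (α : Fin N → ℝ) (hα : ∀ j, 0 < α j)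
    (σ : ℝ) (hσ : σ = 1 ∨ σ = -1) (X : ArrVertex k N) :
    -- for admissible `ρ` the integrals converge and do not depend on `ρ`
    (∀ lam ρ : ℂ, GenericArrangement.Admissible σ lam ρ → ∀ X' : ArrVertex k N,
      IntegrableOn (A.integrand α ρ X X' lam) (A.cone X) ∧
      A.solution α σ X lam X' = A.rhoIntegral α ρ X X' lam) ∧
    -- `I^±_X` solves `I' = -(𝒜 + ℬ/λ) I`
    (∀ lam ∈ slitDomain σ,
      HasDerivAt (fun μ => A.solution α σ X μ)
        (-((A.matA + lam⁻¹ • A.matB α).mulVec (A.solution α σ X lam))) lam) ∧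
    -- asymptotics, uniformly in the sector `S_±`
    (∀ ε : ℝ, 0 < ε → ε < Real.pi / 2 →
      (fun lam => A.solution α σ X lam)
        ~[Bornology.cobounded ℂ ⊓ 𝓟 (stokesSector σ ε)]
      (fun lam => (((A.coneSign X * A.constD α X : ℝ) : ℂ) *
          Complex.exp (-lam * (A.f0 (A.point X) : ℂ)) *
          sectorPow σ lam (-(GenericArrangement.weight α X.1 : ℂ))) •
        (Pi.single X 1 : ArrVertex k N → ℂ))) := by
  refine ⟨fun lam ρ h X' => ⟨?_, A.solution_eq_rhoIntegral X hα X' h.mem_wedge⟩,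
    fun lam hlam => A.hasDerivAt_solution X hα hσ hlam,
    fun ε hε hε' => A.isEquivalent_solution X hα hσ hε (by linarith)⟩
  exact A.integrableOn_integrand X hα (GenericArrangement.im_ne_zero_of_mem_wedge h.mem_wedge) X'
    h.mem_wedge.2
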